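/- Let $(\mathcal{C},\mathbb{E},\mathfrak{s})$ be an extriangulated category in the sense of Nakaoka and Palu: $\mathcal{C}$ is an additive category, $\mathbb{E}:\mathcal{C}^{\mathrm{op}}\times\mathcal{C}\to \mathrm{Ab}$ is an additive bifunctor, and $\mathfrak{s}$ is an additive realization of $\mathbb{E}$, subject to (ET3), (ET3)$^{\mathrm{op}}$, (ET4) and (ET4)$^{\mathrm{op}}$. A sequence $A\xrightarrow{x}B\xrightarrow{y}C$ realizing some $\delta\in\mathbb{E}(C,A)$ is, together with $\delta$, called an $\mathfrak{s}$-triangle; then $x$ is an $\mathfrak{s}$-inflation and $y$ an $\mathfrak{s}$-deflation. Let $\mathcal{P}$ be the full subcategory of projective objects (those $P$ such that every morphism $P\to C$ lifts along every $\mathfrak{s}$-deflation $B\to C$) and $\mathcal{I}$ the full subcategory of injective objects (those $I$ such that every morphism $A\to I$ extends along every $\mathfrak{s}$-inflation $A\to B$). Assume that $\mathcal{C}$ has enough projectives and enough injectives: every object $X$ admits $\mathfrak{s}$-triangles $K\to P\to X$ with $P\in\mathcal{P}$ and $X\to I\to L$ with $I\in\mathcal{I}$. Let $\mathcal{M}$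 be a cluster tilting subcategory of $\mathcal{C}$, that is, a full subcategory such that - $\mathcal{M}$ is functorially finite: for every object $X$ of $\mathcal{C}$ there are a morphism $M\to X$ with $M\in\mathcal{M}$ through which every morphism from an object of $\mathcal{M}$ to $X$ factors, and a morphism $X\to M'$ with $M'\in\mathcal{M}$ through which every morphism from $X$ to an object of $\mathcal{M}$ factors; - $X\in\mathcal{M}$ if and only if $\mathbb{E}(X,M)=0$ for all $M\in\mathcal{M}$; - $X\in\mathcal{M}$ if and only if $\mathbb{E}(M,X)=0$ for all $M\in\mathcal{M}$. Let $\Omega\mathcal{M}$ be the full subcategory of the objects $X$ that admit an $\mathfrak{s}$-triangle $X\to P\to M$ with $P\in\mathcal{P}$ and $M\in\mathcal{M}$, and let $\Sigma\mathcal{M}$ be the full subcategory of the objects $X$ that admit an $\mathfrak{s}$-triangle $M\to I\to X$ with $M\in\mathcal{M}$ and $I\in\mathcal{I}$. For a full additive subcategory $\mathcal{D}$ of an additive category $\mathcal{A}$, let $[\mathcal{D}]$ be the ideal of the morphisms that factor through an object of $\mathcal{D}$ and $\mathcal{A}/[\mathcal{D}]$ the quotient category. For an additive category $\mathcal{A}$,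 let $\mathrm{mod}\text{-}\mathcal{A}$ be the category of finitely presented right $\mathcal{A}$-modules, i.e. of the contravariant additive functors $F:\mathcal{A}\to \mathrm{Ab}$ that admit an exact sequence $\mathcal{A}(-,X)\to\mathcal{A}(-,Y)\to F\to 0$. Then there are equivalences of categories 1. $\mathcal{C}/[\mathcal{M}]\simeq \mathrm{mod}\text{-}(\mathcal{M}/[\mathcal{P}])\simeq\bigl(\mathrm{mod}\text{-}(\mathcal{M}/[\mathcal{I}])^{\mathrm{op}}\bigr)^{\mathrm{op}}$; 2. $\mathcal{C}/[\Omega\mathcal{M}]\simeq\bigl(\mathrm{mod}\text{-}(\mathcal{M}/[\mathcal{P}])^{\mathrm{op}}\bigr)^{\mathrm{op}}$; 3. $\mathcal{C}/[\Sigma\mathcal{M}]\simeq \mathrm{mod}\text{-}(\mathcal{M}/[\mathcal{I}])$. Here $\mathrm{mod}\text{-}(\mathcal{A})^{\mathrm{op}}$ means $\mathrm{mod}\text{-}(\mathcal{A}^{\mathrm{op}})$. -/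

import Mathlib

open CategoryTheory CategoryTheory.Limits Opposite

universe w v u

noncomputable section

/-! ### Quotients of a preadditive category by the ideal of a full subcategory -/

namespace IdealQuot

variable {C : Type u} [Category.{v} C] [Preadditive C]

/-- The ideal `[D]` generated by the identities of the objects of `D`: the finite sums of
morphisms `X ⟶ Y` that factor through an object of `D`. (If `D` is closed under finite direct
sums, these are exactly the morphisms that factor through an object of `D`.) -/
def ideal (D : ObjectProperty C) (X Y : C) : AddSubgroup (X ⟶ Y) :=
  AddSubgroup.closure {f | ∃ (Z : C) (_ : D Z) (p : X ⟶ Z) (q : Z ⟶ Y), p ≫ q = f}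

/-- Two parallel morphisms are identified if their difference lies in `[D]`. -/
def rel (D : ObjectProperty C) : HomRel C := fun X Y f g => f - g ∈ ideal D X Y

lemma comp_mem_ideal (D : ObjectProperty C) {X Y Z : C} (f : X ⟶ Y) {g : Y ⟶ Z}
    (hg : g ∈ ideal D Y Z) : f ≫ g ∈ ideal D X Z := by
  induction hg using AddSubgroup.closure_induction with
  | mem x hx =>
    obtain ⟨W, hW, p, q, rfl⟩ := hx
    exact AddSubgroup.subset_closure ⟨W, hW, f ≫ p, q, by simp⟩
  | zero => simp
  | add x y _ _ hx hy => simpa using (ideal D X Z).add_mem hx hy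
  | neg x _ hx => simpa using (ideal D X Z).neg_mem hx

lemma mem_ideal_comp (D : ObjectProperty C) {X Y Z : C} {f : X ⟶ Y} (g : Y ⟶ Z)
    (hf : f ∈ ideal D X Y) : f ≫ g ∈ ideal D X Z := by
  induction hf using AddSubgroup.closure_induction with
  | mem x hx =>
    obtain ⟨W, hW, p, q, rfl⟩ := hx
    exact AddSubgroup.subset_closure ⟨W, hW, p, q ≫ g, by simp⟩
  | zero => simp
  | add x y _ _ hx hy => simpa using (ideal D X Z).add_mem hx hy
  | neg x _ hx => simpa using (ideal D X Z).neg_mem hx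

instance (D : ObjectProperty C) : Congruence (rel D) where
  equivalence :=
    { refl := fun f => by simp [rel]
      symm := fun {f g} h => by simpa [rel] using (ideal D _ _).neg_mem h
      trans := fun {f g h} h₁ h₂ => by simpa [rel] using (ideal D _ _).add_mem h₁ h₂ }
  comp_left f _ _ h := by simpa [rel] using comp_mem_ideal D f h
  comp_right g h := by simpa [rel] using mem_ideal_comp D g h

lemma rel_add (D : ObjectProperty C) ⦃X Y : C⦄ (f₁ f₂ g₁ g₂ : X ⟶ Y)
    (hf : rel D f₁ f₂) (hg : rel D g₁ g₂) : rel D (f₁ + g₁) (f₂ + g₂) := by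
  have h := (ideal D X Y).add_mem hf hg
  rw [show f₁ - f₂ + (g₁ - g₂) = f₁ + g₁ - (f₂ + g₂) by abel] at h
  exact h

/-- The additive quotient category `C/[D]`. -/
abbrev _root_.IdealQuot (D : ObjectProperty C) : Type u := CategoryTheory.Quotient (rel D)

instance (D : ObjectProperty C) : Preadditive (IdealQuot D) :=
  CategoryTheory.Quotient.preadditive (rel D) (rel_add D)

/-- For a property `D` of objects of `C`, the quotient `M/[D]` of the full subcategory `M` by
the ideal of those of its objects that lie in `D`. -/
abbrev sub (M D : ObjectProperty C) : Type u := IdealQuot (D.inverseImage M.ι)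

end IdealQuot

/-! ### Finitely presented modules -/

/-- A right `A`-module, that is a contravariant additive functor `F` from `A` to abelian groups,
is finitely presented if there is an exact sequence `A(-, X) ⟶ A(-, Y) ⟶ F ⟶ 0`. -/
def IsFPModule (A : Type u) [Category.{v} A] [Preadditive A] :
    ObjectProperty (Aᵒᵖ ⥤ AddCommGrpCat.{v}) := fun F =>
  F.Additive ∧
    ∃ (X Y : A) (f : X ⟶ Y) (p : preadditiveYoneda.obj Y ⟶ F)
      (h : preadditiveYoneda.map f ≫ p = 0),
      (ShortComplex.mk (preadditiveYoneda.map f) p h).Exact ∧ Epi p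

/-- The category `mod-A` of finitely presented right `A`-modules. -/
abbrev FPMod (A : Type u) [Category.{v} A] [Preadditive A] : Type (max u (v + 1)) :=
  (IsFPModule A).FullSubcategory

/-! ### Extriangulated categories -/

/-- A sequence `A ⟶ B ⟶ C` with prescribed ends `A` and `C`. -/
structure ThreeTerm {𝒞 : Type u} [Category.{v} 𝒞] (A C : 𝒞) where
  /-- the middle term -/
  B : 𝒞
  /-- the first morphism -/
  x : A ⟶ B
  /-- the second morphism -/
  y : B ⟶ C

/-- Two sequences `A ⟶ B ⟶ C` and `A ⟶ B' ⟶ C` are equivalent if there is an isomorphism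
`B ≅ B'` compatible with the identities of `A` and `C`. -/
instance ThreeTerm.setoid {𝒞 : Type u} [Category.{v} 𝒞] (A C : 𝒞) : Setoid (ThreeTerm A C) where
  r S T := ∃ b : S.B ≅ T.B, S.x ≫ b.hom = T.x ∧ b.hom ≫ T.y = S.y
  iseqv :=
    { refl := fun S => ⟨Iso.refl _, by simp, by simp⟩
      symm := by
        rintro S T ⟨b, h₁, h₂⟩
        exact ⟨b.symm, by simp [← h₁], by simp [← h₂]⟩
      trans := by
        rintro S T U ⟨b, h₁, h₂⟩ ⟨c, h₃, h₄⟩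
        exact ⟨b ≪≫ c, by simp [← h₃, ← h₁], by simp [h₄, h₂]⟩ }

/-- An additive bifunctor `𝔼 : 𝒞ᵒᵖ × 𝒞 ⥤ Ab` with an assignment `𝔰` of an equivalence class of
sequences `A ⟶ B ⟶ C` to every extension `δ ∈ 𝔼(C, A)`. -/
structure PreExtriangulation (𝒞 : Type u) [Category.{v} 𝒞] [Preadditive 𝒞] where
  /-- the bifunctor -/
  E : 𝒞ᵒᵖ ⥤ 𝒞 ⥤ AddCommGrpCat.{w}
  additive_left : E.Additive
  additive_right : ∀ X : 𝒞ᵒᵖ, (E.obj X).Additive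
  /-- the correspondence `𝔰` -/
  s : ∀ {A C : 𝒞}, ((E.obj (op C)).obj A) → _root_.Quotient (ThreeTerm.setoid A C)

namespace PreExtriangulation

variable {𝒞 : Type u} [Category.{v} 𝒞] [Preadditive 𝒞] (𝓔 : PreExtriangulation.{w} 𝒞)

/-- The group `𝔼(C, A)` of extensions. -/
abbrev Ext (C A : 𝒞) : Type w := (𝓔.E.obj (op C)).obj A

variable {𝓔}

/-- `a_* δ = 𝔼(C, a)(δ)`. -/
def push {A A' C : 𝒞} (a : A ⟶ A') (δ : 𝓔.Ext C A) : 𝓔.Ext C A' :=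
  (𝓔.E.obj (op C)).map a δ

/-- `c^* δ = 𝔼(c, A)(δ)`. -/
def pull {A C C' : 𝒞} (c : C' ⟶ C) (δ : 𝓔.Ext C A) : 𝓔.Ext C' A :=
  (𝓔.E.map c.op).app A δ

/-- `A ⟶ B ⟶ C` together with `δ` is an `𝔰`-triangle, i.e. the sequence realizes `δ`. -/
def IsTriangle {A B C : 𝒞} (x : A ⟶ B) (y : B ⟶ C) (δ : 𝓔.Ext C A) : Prop :=
  𝓔.s δ = Quotient.mk (ThreeTerm.setoid A C) ⟨B, x, y⟩

/-- The extension `δ ⊕ δ' ∈ 𝔼(C ⊕ C', A ⊕ A')` with components `(δ, 0, 0, δ')`. -/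
def sumExt [HasBinaryBiproducts 𝒞] {A A' C C' : 𝒞} (δ : 𝓔.Ext C A) (δ' : 𝓔.Ext C' A') :
    𝓔.Ext (C ⊞ C') (A ⊞ A') :=
  push biprod.inl (pull biprod.fst δ) + push biprod.inr (pull biprod.snd δ')

end PreExtriangulation

open PreExtriangulation in
/-- The structure of an extriangulated category on an additive category `𝒞`. -/
structure Extriangulation (𝒞 : Type u) [Category.{v} 𝒞] [Preadditive 𝒞]
    [HasBinaryBiproducts 𝒞] extends PreExtriangulation.{w} 𝒞 where
  /-- `𝔰` is a realization: every morphism of extensions is realized by a morphism of the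
  realizing sequences. -/
  realize {A B C A' B' C' : 𝒞} {x : A ⟶ B} {y : B ⟶ C} {δ : toPreExtriangulation.Ext C A}
    {x' : A' ⟶ B'} {y' : B' ⟶ C'} {δ' : toPreExtriangulation.Ext C' A'} :
    IsTriangle x y δ → IsTriangle x' y' δ' →
    ∀ (a : A ⟶ A') (c : C ⟶ C'), push a δ = pull c δ' →
      ∃ b : B ⟶ B', x ≫ b = a ≫ x' ∧ y ≫ c = b ≫ y'
  /-- the zero extension is realized by the split sequence -/
  realize_zero (A C : 𝒞) :
    IsTriangle (biprod.inl : A ⟶ A ⊞ C) (biprod.snd : A ⊞ C ⟶ C)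
      (0 : toPreExtriangulation.Ext C A)
  /-- `𝔰` is compatible with direct sums -/
  realize_sum {A B C A' B' C' : 𝒞} {x : A ⟶ B} {y : B ⟶ C} {δ : toPreExtriangulation.Ext C A}
    {x' : A' ⟶ B'} {y' : B' ⟶ C'} {δ' : toPreExtriangulation.Ext C' A'} :
    IsTriangle x y δ → IsTriangle x' y' δ' →
      IsTriangle (biprod.map x x') (biprod.map y y') (sumExt δ δ')
  /-- (ET3) -/
  et3 {A B C A' B' C' : 𝒞} {x : A ⟶ B} {y : B ⟶ C} {δ : toPreExtriangulation.Ext C A}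
    {x' : A' ⟶ B'} {y' : B' ⟶ C'} {δ' : toPreExtriangulation.Ext C' A'} :
    IsTriangle x y δ → IsTriangle x' y' δ' →
    ∀ (a : A ⟶ A') (b : B ⟶ B'), x ≫ b = a ≫ x' →
      ∃ c : C ⟶ C', y ≫ c = b ≫ y' ∧ push a δ = pull c δ'
  /-- (ET3)ᵒᵖ -/
  et3_op {A B C A' B' C' : 𝒞} {x : A ⟶ B} {y : B ⟶ C} {δ : toPreExtriangulation.Ext C A}
    {x' : A' ⟶ B'} {y' : B' ⟶ C'} {δ' : toPreExtriangulation.Ext C' A'} :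
    IsTriangle x y δ → IsTriangle x' y' δ' →
    ∀ (b : B ⟶ B') (c : C ⟶ C'), y ≫ c = b ≫ y' →
      ∃ a : A ⟶ A', x ≫ b = a ≫ x' ∧ push a δ = pull c δ'
  /-- (ET4) -/
  et4 {A B C D F : 𝒞} {f : A ⟶ B} {f' : B ⟶ D} {δ : toPreExtriangulation.Ext D A}
    {g : B ⟶ C} {g' : C ⟶ F} {δ' : toPreExtriangulation.Ext F B} :
    IsTriangle f f' δ → IsTriangle g g' δ' →
      ∃ (E' : 𝒞) (h : A ⟶ C) (h' : C ⟶ E') (d : D ⟶ E') (e : E' ⟶ F)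
        (δ'' : toPreExtriangulation.Ext E' A),
        f ≫ g = h ∧ f' ≫ d = g ≫ h' ∧ h' ≫ e = g' ∧
        IsTriangle h h' δ'' ∧ IsTriangle d e (push f' δ') ∧
        δ = pull d δ'' ∧ push f δ'' = pull e δ'
  /-- (ET4)ᵒᵖ -/
  et4_op {A B C D F : 𝒞} {f' : D ⟶ A} {f : A ⟶ B} {δ : toPreExtriangulation.Ext B D}
    {g' : F ⟶ B} {g : B ⟶ C} {δ' : toPreExtriangulation.Ext C F} :
    IsTriangle f' f δ → IsTriangle g' g δ' →
      ∃ (E' : 𝒞) (d : D ⟶ E') (e : E' ⟶ F) (h' : E' ⟶ A) (h : A ⟶ C)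
        (δ'' : toPreExtriangulation.Ext C E'),
        d ≫ h' = f' ∧ e ≫ g' = h' ≫ f ∧ f ≫ g = h ∧
        IsTriangle d e (pull g' δ) ∧ IsTriangle h' h δ'' ∧
        δ' = push e δ'' ∧ push d δ = pull g δ''

namespace Extriangulation

variable {𝒞 : Type u} [Category.{v} 𝒞] [Preadditive 𝒞] [HasBinaryBiproducts 𝒞]
  (𝓔 : Extriangulation.{w} 𝒞)

/-- The group `𝔼(C, A)` of extensions. -/
abbrev Ext (C A : 𝒞) : Type w := 𝓔.toPreExtriangulation.Ext C A

/-- `A ⟶ B ⟶ C` together with `δ` is an `𝔰`-triangle. -/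
abbrev IsTriangle {A B C : 𝒞} (x : A ⟶ B) (y : B ⟶ C) (δ : 𝓔.Ext C A) : Prop :=
  PreExtriangulation.IsTriangle (𝓔 := 𝓔.toPreExtriangulation) x y δ

/-- `x` is an `𝔰`-inflation. -/
def IsInflation {A B : 𝒞} (x : A ⟶ B) : Prop :=
  ∃ (C : 𝒞) (y : B ⟶ C) (δ : 𝓔.Ext C A), 𝓔.IsTriangle x y δ

/-- `y` is an `𝔰`-deflation. -/
def IsDeflation {B C : 𝒞} (y : B ⟶ C) : Prop :=
  ∃ (A : 𝒞) (x : A ⟶ B) (δ : 𝓔.Ext C A), 𝓔.IsTriangle x y δ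

/-- The full subcategory `𝒫` of projective objects. -/
def proj : ObjectProperty 𝒞 := fun P =>
  ∀ ⦃B C : 𝒞⦄ (y : B ⟶ C), 𝓔.IsDeflation y → ∀ c : P ⟶ C, ∃ b : P ⟶ B, b ≫ y = c

/-- The full subcategory `ℐ` of injective objects. -/
def inj : ObjectProperty 𝒞 := fun I =>
  ∀ ⦃A B : 𝒞⦄ (x : A ⟶ B), 𝓔.IsInflation x → ∀ a : A ⟶ I, ∃ b : B ⟶ I, x ≫ b = a

/-- Every object `C` admits an `𝔰`-triangle `A ⟶ P ⟶ C` with `P` projective. -/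
def EnoughProj : Prop :=
  ∀ C : 𝒞, ∃ (A P : 𝒞) (x : A ⟶ P) (y : P ⟶ C) (δ : 𝓔.Ext C A), 𝓔.proj P ∧ 𝓔.IsTriangle x y δ

/-- Every object `A` admits an `𝔰`-triangle `A ⟶ I ⟶ C` with `I` injective. -/
def EnoughInj : Prop :=
  ∀ A : 𝒞, ∃ (I C : 𝒞) (x : A ⟶ I) (y : I ⟶ C) (δ : 𝓔.Ext C A), 𝓔.inj I ∧ 𝓔.IsTriangle x y δ

/-- The objects `X` admitting an `𝔰`-triangle `X ⟶ D₁ ⟶ D₂` with `D₁ ∈ 𝒟₁` and `D₂ ∈ 𝒟₂`. -/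
def cocone (𝒟₁ 𝒟₂ : ObjectProperty 𝒞) : ObjectProperty 𝒞 := fun X =>
  ∃ (D₁ D₂ : 𝒞) (x : X ⟶ D₁) (y : D₁ ⟶ D₂) (δ : 𝓔.Ext D₂ X),
    𝒟₁ D₁ ∧ 𝒟₂ D₂ ∧ 𝓔.IsTriangle x y δ

/-- The objects `X` admitting an `𝔰`-triangle `D₁ ⟶ D₂ ⟶ X` with `D₁ ∈ 𝒟₁` and `D₂ ∈ 𝒟₂`. -/
def cone (𝒟₁ 𝒟₂ : ObjectProperty 𝒞) : ObjectProperty 𝒞 := fun X =>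
  ∃ (D₁ D₂ : 𝒞) (x : D₁ ⟶ D₂) (y : D₂ ⟶ X) (δ : 𝓔.Ext X D₁),
    𝒟₁ D₁ ∧ 𝒟₂ D₂ ∧ 𝓔.IsTriangle x y δ

/-- `Ω M = Cocone(𝒫, M)`. -/
def syzygy (M : ObjectProperty 𝒞) : ObjectProperty 𝒞 := 𝓔.cocone 𝓔.proj M

/-- `Σ M = Cone(M, ℐ)`. -/
def cosyzygy (M : ObjectProperty 𝒞) : ObjectProperty 𝒞 := 𝓔.cone M 𝓔.inj

/-- Functorial finiteness: every object has a right and a left `M`-approximation. -/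
structure _root_.IsFunctoriallyFinite (M : ObjectProperty 𝒞) : Prop where
  right (X : 𝒞) : ∃ (N : 𝒞) (f : N ⟶ X), M N ∧
    ∀ (N' : 𝒞), M N' → ∀ g : N' ⟶ X, ∃ h : N' ⟶ N, h ≫ f = g
  left (X : 𝒞) : ∃ (N : 𝒞) (f : X ⟶ N), M N ∧
    ∀ (N' : 𝒞), M N' → ∀ g : X ⟶ N', ∃ h : N ⟶ N', f ≫ h = g

/-- Cluster tilting (that is, `2`-cluster tilting) subcategories. -/
structure IsClusterTilting (M : ObjectProperty 𝒞) : Prop where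
  functoriallyFinite : IsFunctoriallyFinite M
  mem_iff_left (X : 𝒞) : M X ↔ ∀ N : 𝒞, M N → ∀ δ : 𝓔.Ext X N, δ = 0
  mem_iff_right (X : 𝒞) : M X ↔ ∀ N : 𝒞, M N → ∀ δ : 𝓔.Ext N X, δ = 0

end Extriangulation

end

/-! Two functors do all the work. The first sends `X` to `𝔼(-, X)` restricted to `M`; projectives
act as zero, so it lands in modules over `M/[𝒫]`. The second sends `X` to `(𝒞/[ℐ])(-, X)` restricted
to `M/[ℐ]`. They induce the equivalences out of `𝒞/[M]` and `𝒞/[Σ M]`. The remaining two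
equivalences follow by applying these to the opposite extriangulated category, which exchanges
projectives with injectives and `Ω` with `Σ`.

Cluster tilting enters through resolutions: every `X` sits in triangles `X ⟶ M₀ ⟶ M₁` and `M₁ ⟶ M₀ ⟶
X` with `M₀, M₁ ∈ M` (`exists_isTriangle_left`, `exists_isTriangle_right`). Since `𝔼` vanishes on
`M`, the long exact sequences turn them into finite presentations of the two modules. Three points
remain.

Fullness: a map of presentations is a square that commutes up to a morphism through a projective
(respectively injective). The lifting property lets one correct the square to commute strictly, and
(ET3)ᵒᵖ or (ET3) produces the morphism of `𝒞`.

Density: any `f : a ⟶ b` in `M` becomes a deflation `a ⊞ P ⟶ b` or an inflation `a ⟶ b ⊞ I` after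
adding a projective or an injective, and the third term of the triangle has the module presented by
`f`.

Kernel: if `f : X ⟶ Y` kills `δ ∈ 𝔼(M₁, X)`, it extends over `M₀`. If instead `M₀ ⟶ X ⟶ Y` factors
through an injective, a weak pushout (`exists_weak_pushout`) factors `f` through the cone of an
inflation from `M₁` to an injective, an object of `Σ M`. -/

noncomputable section

/-! ### Functoriality of the extension groups -/

namespace PreExtriangulation

variable {𝒞 : Type u} [Category.{v} 𝒞] [Preadditive 𝒞] {𝓔 : PreExtriangulation.{w} 𝒞}

@[simp] lemma push_zero {A A' C : 𝒞} (a : A ⟶ A') : push a (0 : 𝓔.Ext C A) = 0 := map_zero _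

@[simp] lemma pull_zero {A C C' : 𝒞} (c : C' ⟶ C) : pull c (0 : 𝓔.Ext C A) = 0 := map_zero _

lemma push_add {A A' C : 𝒞} (a : A ⟶ A') (δ ε : 𝓔.Ext C A) :
    push a (δ + ε) = push a δ + push a ε := map_add _ _ _

lemma pull_add {A C C' : 𝒞} (c : C' ⟶ C) (δ ε : 𝓔.Ext C A) :
    pull c (δ + ε) = pull c δ + pull c ε := map_add _ _ _

@[simp] lemma push_id {A C : 𝒞} (δ : 𝓔.Ext C A) : push (𝟙 A) δ = δ := by simp [push]

@[simp] lemma pull_id {A C : 𝒞} (δ : 𝓔.Ext C A) : pull (𝟙 C) δ = δ := by simp [pull]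

lemma push_comp {A A' A'' C : 𝒞} (a : A ⟶ A') (a' : A' ⟶ A'') (δ : 𝓔.Ext C A) :
    push (a ≫ a') δ = push a' (push a δ) := by simp [push]

lemma pull_comp {A C C' C'' : 𝒞} (c : C' ⟶ C) (c' : C'' ⟶ C') (δ : 𝓔.Ext C A) :
    pull (c' ≫ c) δ = pull c' (pull c δ) := by simp [pull]

lemma push_pull {A A' C C' : 𝒞} (a : A ⟶ A') (c : C' ⟶ C) (δ : 𝓔.Ext C A) :
    push a (pull c δ) = pull c (push a δ) := by
  exact (ConcreteCategory.congr_hom ((𝓔.E.map c.op).naturality a) δ).symm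

lemma add_push {A A' C : 𝒞} (a b : A ⟶ A') (δ : 𝓔.Ext C A) :
    push (a + b) δ = push a δ + push b δ := by
  have := 𝓔.additive_right (op C)
  simp [push, Functor.map_add]

lemma add_pull {A C C' : 𝒞} (c d : C' ⟶ C) (δ : 𝓔.Ext C A) :
    pull (c + d) δ = pull c δ + pull d δ := by
  have := 𝓔.additive_left
  simp [pull, Functor.map_add]

@[simp] lemma zero_push {A A' C : 𝒞} (δ : 𝓔.Ext C A) : push (0 : A ⟶ A') δ = 0 := by
  have := add_push (0 : A ⟶ A') 0 δ
  simpa using this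

@[simp] lemma zero_pull {A C C' : 𝒞} (δ : 𝓔.Ext C A) : pull (0 : C' ⟶ C) δ = 0 := by
  have := add_pull (0 : C' ⟶ C) 0 δ
  simpa using this

lemma exists_isTriangle {A C : 𝒞} (δ : 𝓔.Ext C A) :
    ∃ (B : 𝒞) (x : A ⟶ B) (y : B ⟶ C), IsTriangle x y δ := by
  obtain ⟨⟨B, x, y⟩, h⟩ := Quotient.exists_rep (𝓔.s δ)
  exact ⟨B, x, y, h.symm⟩

lemma IsTriangle.of_iso {A B B' C : 𝒞} {x : A ⟶ B} {y : B ⟶ C} {δ : 𝓔.Ext C A}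
    (h : IsTriangle x y δ) (b : B ≅ B') {x' : A ⟶ B'} {y' : B' ⟶ C}
    (hx : x ≫ b.hom = x') (hy : b.hom ≫ y' = y) : IsTriangle x' y' δ :=
  h.trans (Quotient.sound ⟨b, hx, hy⟩)

lemma IsTriangle.congr {A B C : 𝒞} {x x' : A ⟶ B} {y y' : B ⟶ C} {δ δ' : 𝓔.Ext C A}
    (h : IsTriangle x y δ) (hx : x = x') (hy : y = y') (hδ : δ = δ') : IsTriangle x' y' δ' := by
  subst hx hy hδ
  exact h

lemma eq_zero_of_retract_left {A C C' : 𝒞} (i : C ⟶ C') (r : C' ⟶ C) (h : i ≫ r = 𝟙 C)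
    {δ : 𝓔.Ext C A} (hδ : pull r δ = 0) : δ = 0 := by
  rw [← pull_id δ, ← h, pull_comp, hδ, pull_zero]

lemma eq_zero_of_retract_right {A A' C : 𝒞} (i : A ⟶ A') (r : A' ⟶ A) (h : i ≫ r = 𝟙 A)
    {δ : 𝓔.Ext C A} (hδ : push i δ = 0) : δ = 0 := by
  rw [← push_id δ, ← h, push_comp, hδ, push_zero]

lemma eq_zero_of_biprod_left [HasBinaryBiproducts 𝒞] {A C C' : 𝒞} (δ : 𝓔.Ext (C ⊞ C') A)
    (h : pull biprod.inl δ = 0) (h' : pull biprod.inr δ = 0) : δ = 0 := by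
  rw [← pull_id δ, ← biprod.total, add_pull, pull_comp, pull_comp, h, h']
  simp

end PreExtriangulation

/-! ### Exact sequences attached to an `𝔰`-triangle -/

namespace Extriangulation

open PreExtriangulation

variable {𝒞 : Type u} [Category.{v} 𝒞] [Preadditive 𝒞] [HasBinaryBiproducts 𝒞]
  {𝓔 : Extriangulation.{w} 𝒞}

section Exact

variable {A B C : 𝒞} {x : A ⟶ B} {y : B ⟶ C} {δ : 𝓔.Ext C A}

/-- The split triangle on `A` and `T` maps to the given one because `g^* δ = 0 = (𝟙 A)_* 0`; the
`T`-component of the middle map is the lift. -/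
lemma exists_lift_of_pull_eq_zero (h : 𝓔.IsTriangle x y δ) {T : 𝒞} (g : T ⟶ C)
    (hg : pull g δ = 0) : ∃ t : T ⟶ B, t ≫ y = g := by
  obtain ⟨b, -, hb⟩ := 𝓔.realize (𝓔.realize_zero A T) h (𝟙 A) g (by simp [hg])
  exact ⟨biprod.inr ≫ b, by simp [← hb]⟩

lemma exists_extend_of_push_eq_zero (h : 𝓔.IsTriangle x y δ) {T : 𝒞} (g : A ⟶ T)
    (hg : push g δ = 0) : ∃ t : B ⟶ T, x ≫ t = g := by
  obtain ⟨b, hb, -⟩ := 𝓔.realize h (𝓔.realize_zero T C) g (𝟙 C) (by simp [hg])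
  exact ⟨b ≫ biprod.fst, by rw [← Category.assoc, hb]; simp⟩

/-- Realize `ε` by a sequence from `A` to `T`. Since `x_* ε = 0`, the map `x` extends over its
middle term, and (ET3) turns this extension into `g`. -/
lemma exists_pull_of_push_eq_zero (h : 𝓔.IsTriangle x y δ) {T : 𝒞} (ε : 𝓔.Ext T A)
    (hε : push x ε = 0) : ∃ g : T ⟶ C, pull g δ = ε := by
  obtain ⟨B', x', y', h'⟩ := exists_isTriangle ε
  obtain ⟨r, hr⟩ := exists_extend_of_push_eq_zero h' x hε
  obtain ⟨c, -, hc⟩ := 𝓔.et3 h' h (𝟙 A) r (by simp [hr])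
  exact ⟨c, by simpa using hc.symm⟩

lemma exists_push_of_pull_eq_zero (h : 𝓔.IsTriangle x y δ) {T : 𝒞} (ε : 𝓔.Ext C T)
    (hε : pull y ε = 0) : ∃ g : A ⟶ T, push g δ = ε := by
  obtain ⟨B', x', y', h'⟩ := exists_isTriangle ε
  obtain ⟨r, hr⟩ := exists_lift_of_pull_eq_zero h' y hε
  obtain ⟨a, -, ha⟩ := 𝓔.et3_op h h' r (𝟙 C) (by simp [hr])
  exact ⟨a, by simpa using ha⟩

variable [HasZeroObject 𝒞]

open ZeroObject

/-- This and the next four lemmas compare the triangle with a split triangle one of whose end terms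
is zero. -/
lemma comp_eq_zero (h : 𝓔.IsTriangle x y δ) : x ≫ y = 0 := by
  obtain ⟨c, hc, -⟩ := 𝓔.et3 (𝓔.realize_zero A 0) h (𝟙 A) (biprod.fst ≫ x) (by simp)
  have := biprod.inl ≫= hc
  simpa using this.symm

lemma push_eq_zero (h : 𝓔.IsTriangle x y δ) : push x δ = 0 := by
  obtain ⟨c, -, hc⟩ := 𝓔.et3 h (𝓔.realize_zero B 0) x biprod.inl rfl
  simpa using hc

lemma pull_eq_zero (h : 𝓔.IsTriangle x y δ) : pull y δ = 0 := by
  obtain ⟨a, -, ha⟩ := 𝓔.et3_op (𝓔.realize_zero 0 B) h biprod.snd y rfl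
  simpa using ha.symm

lemma exists_factor_left (h : 𝓔.IsTriangle x y δ) {T : 𝒞} (g : T ⟶ B) (hg : g ≫ y = 0) :
    ∃ t : T ⟶ A, t ≫ x = g := by
  obtain ⟨a, ha, -⟩ := 𝓔.et3_op (𝓔.realize_zero T 0) h (biprod.fst ≫ g) 0 (by simp [hg])
  exact ⟨a, by simp [← ha]⟩

lemma exists_factor_right (h : 𝓔.IsTriangle x y δ) {T : 𝒞} (g : B ⟶ T) (hg : x ≫ g = 0) :
    ∃ t : C ⟶ T, y ≫ t = g := by
  obtain ⟨c, hc, -⟩ := 𝓔.et3 h (𝓔.realize_zero 0 T) 0 (g ≫ biprod.inr)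
    (by simp [← Category.assoc, hg])
  exact ⟨c, by simp [hc]⟩

lemma isTriangle_zero_id (B : 𝒞) : 𝓔.IsTriangle (0 : (0 : 𝒞) ⟶ B) (𝟙 B) 0 :=
  (𝓔.realize_zero 0 B).of_iso
    { hom := biprod.snd, inv := biprod.inr
      hom_inv_id := by cat_disch
      inv_hom_id := by simp } (by simp) (by simp)

lemma isTriangle_id_zero (B : 𝒞) : 𝓔.IsTriangle (𝟙 B) (0 : B ⟶ (0 : 𝒞)) 0 :=
  (𝓔.realize_zero B 0).of_iso
    { hom := biprod.fst, inv := biprod.inl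
      hom_inv_id := by cat_disch
      inv_hom_id := by simp } (by simp) (by ext)

end Exact

section Iso

variable [HasZeroObject 𝒞]

/-- The difference `e - 𝟙` factors through `x`, and `x` kills `e - 𝟙`. Hence `e - 𝟙` squares to zero
and `2 - e` is inverse to `e`. -/
lemma isIso_of_endomorphism {A B C : 𝒞} {x : A ⟶ B} {y : B ⟶ C} {δ : 𝓔.Ext C A}
    (h : 𝓔.IsTriangle x y δ) (e : B ⟶ B) (hx : x ≫ e = x) (hy : e ≫ y = y) : IsIso e := by
  obtain ⟨s, hs⟩ := exists_factor_left h (e - 𝟙 B) (by simp [hy])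
  have hn : (e - 𝟙 B) ≫ (e - 𝟙 B) = 0 := by
    nth_rw 1 [← hs]
    simp [hx]
  have hn' : e ≫ e = e + e - 𝟙 B := by
    rw [← sub_eq_zero, ← hn]
    simp only [Preadditive.sub_comp, Preadditive.comp_sub, Category.comp_id, Category.id_comp]
    abel
  refine ⟨𝟙 B + 𝟙 B - e, ?_, ?_⟩ <;>
    simp [hn']

lemma isIso_of_morphism {A B C A' B' C' : 𝒞} {x : A ⟶ B} {y : B ⟶ C} {δ : 𝓔.Ext C A}
    {x' : A' ⟶ B'} {y' : B' ⟶ C'} {δ' : 𝓔.Ext C' A'} (h : 𝓔.IsTriangle x y δ)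
    (h' : 𝓔.IsTriangle x' y' δ') (a : A ≅ A') (c : C ≅ C') (b : B ⟶ B')
    (hx : x ≫ b = a.hom ≫ x') (hy : y ≫ c.hom = b ≫ y')
    (hδ : push a.hom δ = pull c.hom δ') : IsIso b := by
  obtain ⟨b', hx', hy'⟩ := 𝓔.realize h' h a.inv c.inv (by
    rw [← pull_id δ', ← c.inv_hom_id, pull_comp, ← hδ, push_pull, ← push_comp]
    simp)
  have h₁ := isIso_of_endomorphism h (b ≫ b') (by simp [hx', reassoc_of% hx])
    (by simp [← hy', ← reassoc_of% hy])
  have h₂ := isIso_of_endomorphism h' (b' ≫ b) (by simp [reassoc_of% hx', hx])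
    (by simp [← hy, ← reassoc_of% hy'])
  have : IsSplitMono b := ⟨⟨{
      retraction := b' ≫ inv (b ≫ b')
      id := by rw [← Category.assoc, IsIso.hom_inv_id] }⟩⟩
  have : Epi b := epi_of_epi b' b
  exact isIso_of_epi_of_isSplitMono b

/-- Equivalence of sequences fixes the end terms. Changing them as well is needed for the opposite
structure, where biproducts are only isomorphic to opposites of biproducts. -/
lemma isTriangle_of_iso {A B C A' B' C' : 𝒞} {x : A ⟶ B} {y : B ⟶ C} {δ : 𝓔.Ext C A}
    {x' : A' ⟶ B'} {y' : B' ⟶ C'} {δ' : 𝓔.Ext C' A'} (h : 𝓔.IsTriangle x y δ)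
    (a : A ≅ A') (b : B ≅ B') (c : C ≅ C') (hx : x ≫ b.hom = a.hom ≫ x')
    (hy : y ≫ c.hom = b.hom ≫ y') (hδ : push a.hom δ = pull c.hom δ') :
    𝓔.IsTriangle x' y' δ' := by
  obtain ⟨B₀, x₀, y₀, h₀⟩ := exists_isTriangle δ'
  obtain ⟨β, hβ, hβ'⟩ := 𝓔.realize h h₀ a.hom c.hom hδ
  have := isIso_of_morphism h h₀ a c β hβ hβ' hδ
  refine h₀.of_iso ((asIso β).symm ≪≫ b) ?_ ?_
  · rw [← cancel_epi a.hom, ← hx, ← reassoc_of% hβ]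
    simp
  · simp [← hy, hβ']

end Iso

/-- The triangle `B ⟶ B ⊞ C ⟶ C` given by the graph of `-f` and by `(f, 𝟙)`. -/
lemma isTriangle_graph {B C : 𝒞} (f : B ⟶ C) :
    𝓔.IsTriangle (biprod.lift (𝟙 B) (-f)) (biprod.desc f (𝟙 C)) 0 :=
  (𝓔.realize_zero B C).of_iso
    { hom := biprod.desc (biprod.lift (𝟙 B) (-f)) biprod.inr
      inv := biprod.desc (biprod.lift (𝟙 B) f) biprod.inr
      hom_inv_id := by ext <;> simp
      inv_hom_id := by ext <;> simp } (by simp) (by ext <;> simp)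

/-- The triangle `B ⟶ B ⊞ C ⟶ C` given by the graph of `f` and by `(-f, 𝟙)`. -/
lemma isTriangle_graph' {B C : 𝒞} (f : B ⟶ C) :
    𝓔.IsTriangle (biprod.lift (𝟙 B) f) (biprod.desc (-f) (𝟙 C)) 0 :=
  (isTriangle_graph (-f)).congr (by simp) rfl rfl

/-! ### Completing morphisms to deflations and inflations; weak pushouts -/

variable [HasZeroObject 𝒞]

open ZeroObject

/-- The map is the composite of `𝟙 ⊕ y : B ⊞ P ⟶ B ⊞ C` with the split deflation `(f, 𝟙) : B ⊞ C ⟶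
C`, and (ET4)ᵒᵖ composes deflations. -/
lemma isDeflation_desc {B P C : 𝒞} (f : B ⟶ C) {y : P ⟶ C} (hy : 𝓔.IsDeflation y) :
    𝓔.IsDeflation (biprod.desc f y) := by
  obtain ⟨K, x, δ, h⟩ := hy
  obtain ⟨E', d, e, h', g, δ'', -, -, hg, -, ht, -, -⟩ :=
    𝓔.et4_op (𝓔.realize_sum (isTriangle_zero_id B) h) (isTriangle_graph f)
  exact ⟨E', h', δ'', ht.congr rfl (by rw [← hg]; ext <;> simp) rfl⟩

lemma isInflation_lift {A B I : 𝒞} (f : A ⟶ B) {x : A ⟶ I} (hx : 𝓔.IsInflation x) :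
    𝓔.IsInflation (biprod.lift f x) := by
  obtain ⟨L, y, δ, h⟩ := hx
  have h₁ : 𝓔.IsTriangle (biprod.lift f (𝟙 A)) (biprod.desc (𝟙 B) (-f)) 0 :=
    (𝓔.isTriangle_graph' f).of_iso (biprod.braiding A B) (by ext <;> simp) (by ext <;> simp)
  obtain ⟨E', g, h', d, e, δ'', hg, -, -, ht, -⟩ :=
    𝓔.et4 h₁ (𝓔.realize_sum (isTriangle_id_zero B) h)
  exact ⟨E', h', δ'', ht.congr (by rw [← hg]; ext <;> simp) rfl rfl⟩

/-- For a triangle `A ⟶ B ⟶ C` and an inflation `i : B ⟶ I`, the cone `Z` of `A ⟶ B ⟶ I` is a weak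
pushout of `C ⟵ B ⟶ I`. -/
lemma exists_weak_pushout {A B C I : 𝒞} {x : A ⟶ B} {y : B ⟶ C} {δ : 𝓔.Ext C A}
    (h : 𝓔.IsTriangle x y δ) {i : B ⟶ I} (hi : 𝓔.IsInflation i) :
    ∃ (Z : 𝒞) (z : I ⟶ Z) (d : C ⟶ Z) (δ' : 𝓔.Ext Z A), 𝓔.IsTriangle (x ≫ i) z δ' ∧
      ∀ {T : 𝒞} (f : C ⟶ T) (g : I ⟶ T), y ≫ f = i ≫ g → ∃ k : Z ⟶ T, d ≫ k = f := by
  obtain ⟨L, p, lam, hp⟩ := hi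
  obtain ⟨Z, _, z, d, e, δ', rfl, hd, -, hz, hde, -, -⟩ := 𝓔.et4 h hp
  refine ⟨Z, z, d, δ', hz, fun {T} f g hfg => ?_⟩
  -- `W` is the cone of `(i, -y) : B ⟶ I ⊞ C`, so a compatible pair `(g, f)` factors through it by
  -- construction.
  obtain ⟨W, _, z', d', e', ε, rfl, hd', -, hz', hde', -, -⟩ :=
    𝓔.et4 (isTriangle_graph y) (𝓔.realize_sum hp (isTriangle_id_zero C))
  -- Along `L ⟶ L ⊞ 0`, the sequences `C ⟶ Z ⟶ L` and `C ⟶ W ⟶ L ⊞ 0` realize the same extension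
  -- `y_* lam`. This gives a map `Z ⟶ W` under `C`.
  obtain ⟨b, hb, -⟩ := 𝓔.realize hde hde' (𝟙 C) biprod.inl (by
    simp [sumExt, ← pull_comp, ← push_comp, ← push_pull])
  obtain ⟨k, hk⟩ := exists_factor_right hz' (biprod.desc g f) (by
    simp [biprod.lift_eq, hfg])
  refine ⟨b ≫ k, ?_⟩
  rw [← Category.assoc, hb, Category.id_comp]
  have := biprod.inr ≫= hd' =≫ k
  simpa [hk] using this

end Extriangulation

/-! ### The opposite extriangulated category -/

/-- The sequence `C ⟶ B ⟶ A` in the opposite category. -/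
@[simps]
def ThreeTerm.op {𝒞 : Type u} [Category.{v} 𝒞] {A C : 𝒞} (S : ThreeTerm A C) :
    ThreeTerm (Opposite.op C) (Opposite.op A) where
  B := Opposite.op S.B
  x := S.y.op
  y := S.x.op

lemma ThreeTerm.op_equiv_op_iff {𝒞 : Type u} [Category.{v} 𝒞] {A C : 𝒞} (S T : ThreeTerm A C) :
    S.op ≈ T.op ↔ S ≈ T := by
  constructor
  · rintro ⟨b, h₁, h₂⟩
    have h₁' : b.hom.unop ≫ S.y = T.y := Quiver.Hom.op_inj h₁
    have h₂' : T.x ≫ b.hom.unop = S.x := Quiver.Hom.op_inj h₂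
    let e : T.B ≅ S.B := b.unop
    exact ⟨e.symm, (Iso.comp_inv_eq e).2 h₂'.symm, (Iso.inv_comp_eq e).2 h₁'.symm⟩
  · rintro ⟨b, h₁, h₂⟩
    refine ⟨b.symm.op, Quiver.Hom.unop_inj ?_, Quiver.Hom.unop_inj ?_⟩
    · change b.inv ≫ S.y = T.y
      simp [← h₂]
    · change T.x ≫ b.inv = S.x
      simp [← h₁]

namespace PreExtriangulation

variable {𝒞 : Type u} [Category.{v} 𝒞] [Preadditive 𝒞] (𝓔 : PreExtriangulation.{w} 𝒞)

/-- The opposite of a bifunctor with a realization. -/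
def op : PreExtriangulation.{w} 𝒞ᵒᵖ where
  E := unopUnop 𝒞 ⋙ 𝓔.E.flip
  additive_left :=
    { map_add := fun {X Y f g} => by
        ext Z δ
        exact add_push (𝓔 := 𝓔) f.unop.unop g.unop.unop δ }
  additive_right X :=
    { map_add := fun {Y Z f g} => by
        ext δ
        exact add_pull (𝓔 := 𝓔) f.unop g.unop δ }
  s {A C} δ := Quotient.map (sa := ThreeTerm.setoid C.unop A.unop) ThreeTerm.op
    (fun S T h => (S.op_equiv_op_iff T).2 h) (𝓔.s δ)

variable {𝓔}

lemma isTriangle_op_iff {A B C : 𝒞ᵒᵖ} (x : A ⟶ B) (y : B ⟶ C) (δ : 𝓔.Ext A.unop C.unop) :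
    IsTriangle (𝓔 := 𝓔.op) (A := A) (C := C) x y δ ↔ IsTriangle y.unop x.unop δ := by
  obtain ⟨S, hS⟩ := Quotient.exists_rep (𝓔.s δ)
  have : 𝓔.op.s (A := A) (C := C) δ = Quotient.mk _ S.op := by
    change Quotient.map _ (fun S T h => (S.op_equiv_op_iff T).2 h) (𝓔.s δ) = _
    rw [← hS]
    rfl
  unfold IsTriangle
  rw [this, ← hS]
  exact Quotient.eq.trans ((ThreeTerm.op_equiv_op_iff S ⟨B.unop, y.unop, x.unop⟩).trans
    Quotient.eq.symm)

end PreExtriangulation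

namespace Extriangulation

open PreExtriangulation

variable {𝒞 : Type u} [Category.{v} 𝒞] [Preadditive 𝒞] [HasBinaryBiproducts 𝒞] [HasZeroObject 𝒞]
  (𝓔 : Extriangulation.{w} 𝒞)

omit [HasZeroObject 𝒞] in
lemma isTriangle_op_realize_zero (A C : 𝒞ᵒᵖ) :
    PreExtriangulation.IsTriangle (𝓔 := 𝓔.toPreExtriangulation.op) (biprod.inl : A ⟶ A ⊞ C) biprod.snd
      (0 : 𝓔.Ext A.unop C.unop) := by
  -- The braiding appears because passing to the opposite exchanges the two end terms of the split
  -- sequence.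
  refine (isTriangle_op_iff _ _ _).2 ((𝓔.realize_zero C.unop A.unop).of_iso
    (biprod.braiding C.unop A.unop ≪≫ (biprod.opIso A.unop C.unop).unop.symm) ?_ ?_)
  · have := congr_arg Quiver.Hom.unop (biprod.opIso_inv_inr_op A.unop C.unop)
    rw [← this, Iso.trans_hom, ← Category.assoc]
    congr 1
    ext <;> simp
  · rw [← cancel_epi (biprod.braiding C.unop A.unop).inv]
    simpa using congr_arg Quiver.Hom.unop (biprod.inl_opIso_inv A.unop C.unop)

omit [HasZeroObject 𝒞] in
lemma opIso_inv_comp_map_op {P P' Q Q' : 𝒞} (f : P ⟶ P') (g : Q ⟶ Q') :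
    (biprod.opIso P' Q').inv ≫ (biprod.map f g).op =
      biprod.map f.op g.op ≫ (biprod.opIso P Q).inv := by
  ext <;> simp [← op_comp]

lemma isTriangle_op_realize_sum {A B C A' B' C' : 𝒞ᵒᵖ} {x : A ⟶ B} {y : B ⟶ C}
    {δ : 𝓔.toPreExtriangulation.op.Ext C A} {x' : A' ⟶ B'} {y' : B' ⟶ C'}
    {δ' : 𝓔.toPreExtriangulation.op.Ext C' A'}
    (h : 𝓔.IsTriangle y.unop x.unop δ) (h' : 𝓔.IsTriangle y'.unop x'.unop δ') :
    PreExtriangulation.IsTriangle (biprod.map x x') (biprod.map y y') (sumExt δ δ') := by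
  refine (isTriangle_op_iff _ _ _).2 (isTriangle_of_iso (𝓔.realize_sum h h')
    (biprod.opIso C.unop C'.unop).unop.symm (biprod.opIso B.unop B'.unop).unop.symm
    (biprod.opIso A.unop A'.unop).unop.symm ?_ ?_ ?_)
  · exact congr_arg Quiver.Hom.unop (opIso_inv_comp_map_op y.unop y'.unop)
  · exact congr_arg Quiver.Hom.unop (opIso_inv_comp_map_op x.unop x'.unop)
  -- Under `biprod.opIso`, the opposite of an inclusion is a projection and conversely. The two sums
  -- of extensions then agree because `push` and `pull` commute.
  · let a : A.unop ⊞ A'.unop ⟶ (A ⊞ A').unop := (biprod.opIso A.unop A'.unop).inv.unop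
    let c : C.unop ⊞ C'.unop ⟶ (C ⊞ C').unop := (biprod.opIso C.unop C'.unop).inv.unop
    have hc : biprod.inl ≫ c = (biprod.fst : C ⊞ C' ⟶ C).unop :=
      congr_arg Quiver.Hom.unop (biprod.opIso_inv_inl_op C.unop C'.unop)
    have hc' : biprod.inr ≫ c = (biprod.snd : C ⊞ C' ⟶ C').unop :=
      congr_arg Quiver.Hom.unop (biprod.opIso_inv_inr_op C.unop C'.unop)
    have ha : a ≫ (biprod.inl : A ⟶ A ⊞ A').unop = biprod.fst :=
      congr_arg Quiver.Hom.unop (biprod.inl_opIso_inv A.unop A'.unop)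
    have ha' : a ≫ (biprod.inr : A' ⟶ A ⊞ A').unop = biprod.snd :=
      congr_arg Quiver.Hom.unop (biprod.inr_opIso_inv A.unop A'.unop)
    let ε : 𝓔.Ext A.unop C.unop := δ
    let ε' : 𝓔.Ext A'.unop C'.unop := δ'
    change push c (push biprod.inl (pull biprod.fst ε) +
        push biprod.inr (pull biprod.snd ε')) =
      pull a (pull (biprod.inl : A ⟶ A ⊞ A').unop (push (biprod.fst : C ⊞ C' ⟶ C).unop ε) +
        pull (biprod.inr : A' ⟶ A ⊞ A').unop (push (biprod.snd : C ⊞ C' ⟶ C').unop ε'))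
    rw [push_add, pull_add, ← pull_comp, ← pull_comp, ha, ha', ← push_comp, ← push_comp, hc, hc',
      push_pull, push_pull]

/-- The opposite extriangulated structure. -/
def op : Extriangulation.{w} 𝒞ᵒᵖ where
  toPreExtriangulation := 𝓔.toPreExtriangulation.op
  realize {A B C A' B' C' x y δ x' y' δ'} h h' a c hac := by
    replace h := (isTriangle_op_iff _ _ _).1 h
    replace h' := (isTriangle_op_iff _ _ _).1 h'
    obtain ⟨b, h₁, h₂⟩ := 𝓔.realize h' h c.unop a.unop hac.symm
    exact ⟨b.op, Quiver.Hom.unop_inj h₂.symm, Quiver.Hom.unop_inj h₁.symm⟩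
  realize_zero A C := isTriangle_op_realize_zero 𝓔 A C
  realize_sum {A B C A' B' C' x y δ x' y' δ'} h h' := by
    replace h := (isTriangle_op_iff _ _ _).1 h
    replace h' := (isTriangle_op_iff _ _ _).1 h'
    exact isTriangle_op_realize_sum 𝓔 h h'
  et3 {A B C A' B' C' x y δ x' y' δ'} h h' a b hab := by
    replace h := (isTriangle_op_iff _ _ _).1 h
    replace h' := (isTriangle_op_iff _ _ _).1 h'
    obtain ⟨c, h₁, h₂⟩ := 𝓔.et3_op h' h b.unop a.unop (congr_arg Quiver.Hom.unop hab.symm)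
    exact ⟨c.op, Quiver.Hom.unop_inj h₁.symm, h₂.symm⟩
  et3_op {A B C A' B' C' x y δ x' y' δ'} h h' b c hbc := by
    replace h := (isTriangle_op_iff _ _ _).1 h
    replace h' := (isTriangle_op_iff _ _ _).1 h'
    obtain ⟨a, h₁, h₂⟩ := 𝓔.et3 h' h c.unop b.unop (congr_arg Quiver.Hom.unop hbc.symm)
    exact ⟨a.op, Quiver.Hom.unop_inj h₁.symm, h₂.symm⟩
  et4 {A B C D F f f' δ g g' δ'} h h' := by
    replace h := (isTriangle_op_iff _ _ _).1 h
    replace h' := (isTriangle_op_iff _ _ _).1 h'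
    obtain ⟨E', d, e, k', k, ε, h₁, h₂, h₃, h₄, h₅, h₆, h₇⟩ := 𝓔.et4_op h' h
    refine ⟨Opposite.op E', k.op, k'.op, e.op, d.op, ε, Quiver.Hom.unop_inj h₃,
      Quiver.Hom.unop_inj h₂, Quiver.Hom.unop_inj h₁, (isTriangle_op_iff _ _ _).2 h₅,
      (isTriangle_op_iff _ _ _).2 h₄, h₆, h₇.symm⟩
  et4_op {A B C D F f' f δ g' g δ'} h h' := by
    replace h := (isTriangle_op_iff _ _ _).1 h
    replace h' := (isTriangle_op_iff _ _ _).1 h'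
    obtain ⟨E', k, k', d, e, ε, h₁, h₂, h₃, h₄, h₅, h₆, h₇⟩ := 𝓔.et4 h' h
    refine ⟨Opposite.op E', e.op, d.op, k'.op, k.op, ε, Quiver.Hom.unop_inj h₃,
      Quiver.Hom.unop_inj h₂, Quiver.Hom.unop_inj h₁, (isTriangle_op_iff _ _ _).2 h₅,
      (isTriangle_op_iff _ _ _).2 h₄, h₆, h₇.symm⟩

end Extriangulation

/-! ### Projectives, injectives and resolutions by a cluster tilting subcategory -/

namespace Extriangulation

open PreExtriangulation

variable {𝒞 : Type u} [Category.{v} 𝒞] [Preadditive 𝒞] [HasBinaryBiproducts 𝒞]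
  {𝓔 : Extriangulation.{w} 𝒞}

lemma ext_eq_zero_of_proj [HasZeroObject 𝒞] {P A : 𝒞} (hP : 𝓔.proj P) (δ : 𝓔.Ext P A) : δ = 0 := by
  obtain ⟨B, x, y, h⟩ := exists_isTriangle δ
  obtain ⟨s, hs⟩ := hP y ⟨A, x, δ, h⟩ (𝟙 P)
  exact eq_zero_of_retract_left s y hs (pull_eq_zero h)

lemma ext_eq_zero_of_inj [HasZeroObject 𝒞] {I C : 𝒞} (hI : 𝓔.inj I) (δ : 𝓔.Ext C I) : δ = 0 := by
  obtain ⟨B, x, y, h⟩ := exists_isTriangle δ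
  obtain ⟨r, hr⟩ := hI x ⟨C, y, δ, h⟩ (𝟙 I)
  exact eq_zero_of_retract_right x r hr (push_eq_zero h)

lemma inj_biprod {I J : 𝒞} (hI : 𝓔.inj I) (hJ : 𝓔.inj J) : 𝓔.inj (I ⊞ J) := by
  intro A B x hx a
  obtain ⟨b, hb⟩ := hI x hx (a ≫ biprod.fst)
  obtain ⟨c, hc⟩ := hJ x hx (a ≫ biprod.snd)
  exact ⟨biprod.lift b c, by ext <;> simp [hb, hc]⟩

lemma proj_biprod {P Q : 𝒞} (hP : 𝓔.proj P) (hQ : 𝓔.proj Q) : 𝓔.proj (P ⊞ Q) := by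
  intro B C y hy c
  obtain ⟨b, hb⟩ := hP y hy (biprod.inl ≫ c)
  obtain ⟨d, hd⟩ := hQ y hy (biprod.inr ≫ c)
  exact ⟨biprod.desc b d, by ext <;> simp [hb, hd]⟩

/-- `𝔼(C, A)` is a quotient of `Hom(K, A)` for a syzygy `K` of `C`. -/
lemma small_ext [HasZeroObject 𝒞] (hP : 𝓔.EnoughProj) (C A : 𝒞) : Small.{v} (𝓔.Ext C A) := by
  obtain ⟨K, P, x, y, δ, hP, h⟩ := hP C
  refine small_of_surjective (f := fun g : K ⟶ A => push g δ) fun ε => ?_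
  exact exists_push_of_pull_eq_zero h ε (ext_eq_zero_of_proj hP _)

namespace IsClusterTilting

variable {M : ObjectProperty 𝒞} (hM : 𝓔.IsClusterTilting M)

include hM

lemma ext_eq_zero {X Y : 𝒞} (hX : M X) (hY : M Y) (δ : 𝓔.Ext X Y) : δ = 0 :=
  (hM.mem_iff_left X).1 hX Y hY δ

lemma biprod_mem {X Y : 𝒞} (hX : M X) (hY : M Y) : M (X ⊞ Y) :=
  (hM.mem_iff_left _).2 fun _ hN δ =>
    eq_zero_of_biprod_left δ (hM.ext_eq_zero hX hN _) (hM.ext_eq_zero hY hN _)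

variable [HasZeroObject 𝒞]

lemma proj_le : 𝓔.proj ≤ M := fun X hX => (hM.mem_iff_left X).2 fun _ _ =>
  ext_eq_zero_of_proj hX

lemma inj_le : 𝓔.inj ≤ M := fun X hX => (hM.mem_iff_right X).2 fun _ _ =>
  ext_eq_zero_of_inj hX

/-- A left approximation need not be an inflation. Adding an inflation into an injective, which lies
in `M`, makes it one and keeps the approximation property. -/
lemma exists_isTriangle_left (hI : 𝓔.EnoughInj) (X : 𝒞) :
    ∃ (M₀ M₁ : 𝒞) (x : X ⟶ M₀) (y : M₀ ⟶ M₁) (δ : 𝓔.Ext M₁ X),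
      M M₀ ∧ M M₁ ∧ 𝓔.IsTriangle x y δ := by
  obtain ⟨N, f, hN, hf⟩ := hM.functoriallyFinite.left X
  obtain ⟨I, L, i, p, lam, hI, hi⟩ := hI X
  obtain ⟨Y, y, δ, h⟩ := isInflation_lift f ⟨L, p, lam, hi⟩
  have hNI := hM.biprod_mem hN (hM.inj_le _ hI)
  refine ⟨N ⊞ I, Y, _, y, δ, hNI, ?_, h⟩
  -- Every extension of `Y` by `N'` is `g_* δ` for some `g : X ⟶ N'`. Such a `g` factors through the
  -- inflation out of `X`, which annihilates `δ`.
  refine (hM.mem_iff_left Y).2 fun N' hN' ε => ?_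
  obtain ⟨g, rfl⟩ := exists_push_of_pull_eq_zero h ε (hM.ext_eq_zero hNI hN' _)
  obtain ⟨k, hk⟩ := hf N' hN' g
  have : g = biprod.lift f i ≫ biprod.fst ≫ k := by simp [hk]
  rw [this, push_comp, push_eq_zero h, push_zero]

lemma exists_isTriangle_right (hP : 𝓔.EnoughProj) (X : 𝒞) :
    ∃ (M₁ M₀ : 𝒞) (x : M₁ ⟶ M₀) (y : M₀ ⟶ X) (δ : 𝓔.Ext X M₁),
      M M₁ ∧ M M₀ ∧ 𝓔.IsTriangle x y δ := by
  obtain ⟨N, f, hN, hf⟩ := hM.functoriallyFinite.right X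
  obtain ⟨K, P, i, p, lam, hP, hp⟩ := hP X
  obtain ⟨Y, y, δ, h⟩ := isDeflation_desc f ⟨K, i, lam, hp⟩
  have hNP := hM.biprod_mem hN (hM.proj_le _ hP)
  refine ⟨Y, N ⊞ P, y, _, δ, ?_, hNP, h⟩
  refine (hM.mem_iff_right Y).2 fun N' hN' ε => ?_
  obtain ⟨g, rfl⟩ := exists_pull_of_push_eq_zero h ε (hM.ext_eq_zero hN' hNP _)
  obtain ⟨k, hk⟩ := hf N' hN' g
  have : g = (k ≫ biprod.inl) ≫ biprod.desc f p := by simp [hk]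
  rw [this, pull_comp, pull_eq_zero h, pull_zero]

end IsClusterTilting

/-! ### Duality for projectives, injectives and cluster tilting -/

section Opposite

variable [HasZeroObject 𝒞] (𝓔)

lemma op_isTriangle_op {A B C : 𝒞} {x : A ⟶ B} {y : B ⟶ C} {δ : 𝓔.Ext C A}
    (h : 𝓔.IsTriangle x y δ) :
    𝓔.op.IsTriangle (A := Opposite.op C) (C := Opposite.op A) y.op x.op δ :=
  (isTriangle_op_iff (𝓔 := 𝓔.toPreExtriangulation) y.op x.op δ).2 h

lemma isTriangle_unop {A B C : 𝒞ᵒᵖ} {x : A ⟶ B} {y : B ⟶ C} {δ : 𝓔.op.Ext C A}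
    (h : 𝓔.op.IsTriangle x y δ) :
    𝓔.IsTriangle (A := C.unop) (C := A.unop) y.unop x.unop δ :=
  (isTriangle_op_iff (𝓔 := 𝓔.toPreExtriangulation) x y δ).1 h

lemma op_proj : 𝓔.op.proj = 𝓔.inj.op := by
  ext I
  constructor
  · rintro h A B x ⟨C, y, δ, hx⟩ a
    obtain ⟨b, hb⟩ := h x.op ⟨_, _, _, 𝓔.op_isTriangle_op hx⟩ a.op
    exact ⟨b.unop, Quiver.Hom.op_inj hb⟩
  · rintro h B C y ⟨A, x, δ, hy⟩ c
    obtain ⟨b, hb⟩ := h y.unop ⟨_, _, _, 𝓔.isTriangle_unop hy⟩ c.unop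
    exact ⟨b.op, Quiver.Hom.unop_inj hb⟩

lemma op_inj : 𝓔.op.inj = 𝓔.proj.op := by
  ext I
  constructor
  · rintro h B C y ⟨A, x, δ, hy⟩ c
    obtain ⟨b, hb⟩ := h y.op ⟨_, _, _, 𝓔.op_isTriangle_op hy⟩ c.op
    exact ⟨b.unop, Quiver.Hom.op_inj hb⟩
  · rintro h A B x ⟨C, y, δ, hx⟩ a
    obtain ⟨b, hb⟩ := h x.unop ⟨_, _, _, 𝓔.isTriangle_unop hx⟩ a.unop
    exact ⟨b.op, Quiver.Hom.unop_inj hb⟩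

lemma op_cosyzygy (M : ObjectProperty 𝒞) : 𝓔.op.cosyzygy M.op = (𝓔.syzygy M).op := by
  ext X
  constructor
  · rintro ⟨D₁, D₂, x, y, δ, h₁, h₂, h⟩
    rw [op_inj] at h₂
    exact ⟨D₂.unop, D₁.unop, y.unop, x.unop, δ, h₂, h₁, 𝓔.isTriangle_unop h⟩
  · rintro ⟨D₁, D₂, x, y, δ, h₁, h₂, h⟩
    refine ⟨Opposite.op D₂, Opposite.op D₁, y.op, x.op, δ, h₂, ?_, 𝓔.op_isTriangle_op h⟩
    rw [op_inj]
    exact h₁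

variable {𝓔}

lemma EnoughProj.op (h : 𝓔.EnoughProj) : 𝓔.op.EnoughInj := fun X => by
  obtain ⟨A, P, x, y, δ, hP, ht⟩ := h X.unop
  refine ⟨_, _, y.op, x.op, δ, ?_, 𝓔.op_isTriangle_op ht⟩
  rw [op_inj]
  exact hP

lemma EnoughInj.op (h : 𝓔.EnoughInj) : 𝓔.op.EnoughProj := fun X => by
  obtain ⟨I, C, x, y, δ, hI, ht⟩ := h X.unop
  refine ⟨_, _, y.op, x.op, δ, ?_, 𝓔.op_isTriangle_op ht⟩
  rw [op_proj]
  exact hI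

lemma IsClusterTilting.op {M : ObjectProperty 𝒞} (hM : 𝓔.IsClusterTilting M) :
    𝓔.op.IsClusterTilting M.op where
  functoriallyFinite :=
    { right := fun X => by
        obtain ⟨N, f, hN, h⟩ := hM.functoriallyFinite.left X.unop
        refine ⟨Opposite.op N, f.op, hN, fun N' hN' g => ?_⟩
        obtain ⟨k, hk⟩ := h N'.unop hN' g.unop
        exact ⟨k.op, Quiver.Hom.unop_inj hk⟩
      left := fun X => by
        obtain ⟨N, f, hN, h⟩ := hM.functoriallyFinite.right X.unop
        refine ⟨Opposite.op N, f.op, hN, fun N' hN' g => ?_⟩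
        obtain ⟨k, hk⟩ := h N'.unop hN' g.unop
        exact ⟨k.op, Quiver.Hom.unop_inj hk⟩ }
  mem_iff_left X := (hM.mem_iff_right X.unop).trans
    ⟨fun h N hN δ => h N.unop hN δ, fun h N hN δ => h (Opposite.op N) hN δ⟩
  mem_iff_right X := (hM.mem_iff_left X.unop).trans
    ⟨fun h N hN δ => h N.unop hN δ, fun h N hN δ => h (Opposite.op N) hN δ⟩

end Opposite

end Extriangulation

/-! ### Finitely presented modules by generators and relations -/

section Modules

variable {A : Type u} [Category.{v} A] [Preadditive A]

/-- The element `η ∈ G(b)` and `f : a ⟶ b` present `G`: the sequence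
`A(-, a) ⟶ A(-, b) ⟶ G ⟶ 0` given by `f` and `η` is exact. -/
structure IsPresentation (G : Aᵒᵖ ⥤ AddCommGrpCat.{v}) {a b : A} (f : a ⟶ b)
    (η : G.obj (op b)) : Prop where
  map_eq_zero : G.map f.op η = 0
  exists_map_eq (c : A) (ξ : G.obj (op c)) : ∃ g : c ⟶ b, G.map g.op η = ξ
  exists_comp_eq (c : A) (g : c ⟶ b) : G.map g.op η = 0 → ∃ h : c ⟶ a, h ≫ f = g

lemma map_op_add_apply (G : Aᵒᵖ ⥤ AddCommGrpCat.{v}) [G.Additive] {c b : A} (g h : c ⟶ b)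
    (η : G.obj (op b)) : G.map (g + h).op η = G.map g.op η + G.map h.op η := by
  rw [op_add, G.map_add]
  rfl

lemma map_op_sub_apply (G : Aᵒᵖ ⥤ AddCommGrpCat.{v}) [G.Additive] {c b : A} (g h : c ⟶ b)
    (η : G.obj (op b)) : G.map (g - h).op η = G.map g.op η - G.map h.op η := by
  rw [op_sub, G.map_sub]
  rfl

omit [Preadditive A] in
lemma map_op_comp_apply (G : Aᵒᵖ ⥤ AddCommGrpCat.{v}) {d c b : A} (g : d ⟶ c) (h : c ⟶ b)
    (η : G.obj (op b)) : G.map (g ≫ h).op η = G.map g.op (G.map h.op η) := by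
  simp

/-- The morphism `A(-, b) ⟶ G` given by an element of `G(b)`. -/
def yonedaHom (G : Aᵒᵖ ⥤ AddCommGrpCat.{v}) [G.Additive] {b : A} (η : G.obj (op b)) :
    preadditiveYoneda.obj b ⟶ G where
  app c := AddCommGrpCat.ofHom
    (AddMonoidHom.mk' (fun g : c.unop ⟶ b => G.map g.op η) fun g h => map_op_add_apply G g h η)
  naturality c d h := by
    ext g
    exact map_op_comp_apply G h.unop g η

lemma yoneda_app_apply {G : Aᵒᵖ ⥤ AddCommGrpCat.{v}} {b : A} (p : preadditiveYoneda.obj b ⟶ G)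
    {c : A} (g : c ⟶ b) : p.app (op c) g = G.map g.op (p.app (op b) (𝟙 b)) := by
  have := ConcreteCategory.congr_hom (p.naturality g.op) (𝟙 b)
  refine Eq.trans ?_ this
  change p.app (op c) g = p.app (op c) (g ≫ 𝟙 b)
  simp

lemma shortComplex_exact_iff_evaluation {J : Type*} [Category* J]
    (S : ShortComplex (J ⥤ AddCommGrpCat.{v})) :
    S.Exact ↔ ∀ j, (S.map ((evaluation J _).obj j)).Exact := by
  constructor
  · intro h j
    exact h.map ((evaluation J _).obj j)
  · intro h
    rw [S.exact_iff_isZero_homology, Functor.isZero_iff]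
    intro j
    exact (((ShortComplex.exact_iff_isZero_homology _).1 (h j)).of_iso
      (S.mapHomologyIso ((evaluation J _).obj j)).symm)

/-- By the Yoneda lemma, `A(-, b) ⟶ G` is an element of `G(b)`; exactness and epimorphy are tested
objectwise. -/
lemma isFPModule_iff (G : Aᵒᵖ ⥤ AddCommGrpCat.{v}) :
    IsFPModule A G ↔ G.Additive ∧
      ∃ (a b : A) (f : a ⟶ b) (η : G.obj (op b)), IsPresentation G f η := by
  refine and_congr_right fun hG => ⟨?_, ?_⟩
  · rintro ⟨a, b, f, p, h, hex, hp⟩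
    rw [shortComplex_exact_iff_evaluation] at hex
    refine ⟨a, b, f, p.app (op b) (𝟙 b), ?_, fun c ξ => ?_, fun c g hg => ?_⟩
    · rw [← yoneda_app_apply]
      have := ConcreteCategory.congr_hom (NatTrans.congr_app h (op a)) (𝟙 a)
      refine Eq.trans ?_ this
      change p.app (op a) f = p.app (op a) (𝟙 a ≫ f)
      simp
    · have := (AddCommGrpCat.epi_iff_surjective _).1 ((NatTrans.epi_iff_epi_app p).1 hp (op c))
      obtain ⟨g, hg⟩ := this ξ
      exact ⟨g, (yoneda_app_apply p (show c ⟶ b from g)).symm.trans hg⟩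
    · rw [← yoneda_app_apply] at hg
      obtain ⟨k, hk⟩ := (ShortComplex.ab_exact_iff _).1 (hex (op c)) g hg
      exact ⟨k, hk⟩
  · rintro ⟨a, b, f, η, h⟩
    refine ⟨a, b, f, yonedaHom G η, ?_, ?_, ?_⟩
    · ext ⟨c⟩ g
      change G.map (Quiver.Hom.op ((show c ⟶ a from g) ≫ f)) η = 0
      rw [op_comp, G.map_comp]
      simp [h.map_eq_zero]
    · rw [shortComplex_exact_iff_evaluation]
      rintro ⟨c⟩
      rw [ShortComplex.ab_exact_iff]
      intro g hg
      exact h.exists_comp_eq c g hg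
    · rw [NatTrans.epi_iff_epi_app]
      rintro ⟨c⟩
      rw [AddCommGrpCat.epi_iff_surjective]
      exact h.exists_map_eq c

namespace IsPresentation

variable {G G' : Aᵒᵖ ⥤ AddCommGrpCat.{v}} {a b : A} {f : a ⟶ b} {η : G.obj (op b)}

omit [Preadditive A] in
lemma hom_ext (h : IsPresentation G f η) {φ ψ : G ⟶ G'}
    (hφ : φ.app (op b) η = ψ.app (op b) η) : φ = ψ := by
  ext ⟨c⟩ ξ
  obtain ⟨g, rfl⟩ := h.exists_map_eq c ξ
  rw [NatTrans.naturality_apply, NatTrans.naturality_apply, hφ]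

lemma exists_hom [G.Additive] [G'.Additive] (h : IsPresentation G f η) (η' : G'.obj (op b))
    (h' : G'.map f.op η' = 0) : ∃ φ : G ⟶ G', φ.app (op b) η = η' := by
  choose k hk using h.exists_map_eq
  -- The value at `g^* η` must be `g^* η'`. This does not depend on the choice of `g`, since two
  -- choices differ by a morphism through `f`, and `f` kills `η'`.
  have key (c : A) (g : c ⟶ b) : G'.map (k c (G.map g.op η)).op η' = G'.map g.op η' := by
    obtain ⟨t, ht⟩ := h.exists_comp_eq c (k c (G.map g.op η) - g) (by
      rw [map_op_sub_apply, hk, sub_self])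
    rw [← sub_eq_zero, ← map_op_sub_apply, ← ht, map_op_comp_apply, h', map_zero]
  refine ⟨{
    app := fun c => AddCommGrpCat.ofHom
      (AddMonoidHom.mk' (fun ξ => G'.map (k c.unop ξ).op η') fun ξ ζ => ?_)
    naturality := fun c d g => ?_ }, ?_⟩
  · rw [← map_op_add_apply, ← key _ (_ + _), map_op_add_apply, hk, hk]
  · ext ξ
    change G'.map (k d.unop (G.map g ξ)).op η' = G'.map g.unop.op (G'.map (k c.unop ξ).op η')
    rw [← map_op_comp_apply, ← key _ (_ ≫ _), map_op_comp_apply, hk]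
    rfl
  · have := key b (𝟙 b)
    simpa using this

lemma nonempty_iso [G.Additive] [G'.Additive] (h : IsPresentation G f η) {η' : G'.obj (op b)}
    (h' : IsPresentation G' f η') : Nonempty (G ≅ G') := by
  obtain ⟨φ, hφ⟩ := h.exists_hom η' h'.map_eq_zero
  obtain ⟨ψ, hψ⟩ := h'.exists_hom η h.map_eq_zero
  exact ⟨φ, ψ, h.hom_ext (by simp [hφ, hψ]), h'.hom_ext (by simp [hφ, hψ])⟩

end IsPresentation

end Modules

/-! ### Factorization through ideals and functors out of quotient categories -/

namespace IdealQuot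

section

universe v₁ u₁

variable {C : Type u₁} [Category.{v₁} C] [Preadditive C] (D : ObjectProperty C)

instance : (CategoryTheory.Quotient.functor (rel D)).Additive :=
  CategoryTheory.Quotient.functor_additive (rel D) (rel_add D)

lemma functor_map_eq_zero_iff {X Y : C} (f : X ⟶ Y) :
    (CategoryTheory.Quotient.functor (rel D)).map f = 0 ↔ f ∈ ideal D X Y := by
  rw [← Functor.map_zero (CategoryTheory.Quotient.functor (rel D)),
    CategoryTheory.Quotient.functor_map_eq_iff, rel, sub_zero]

variable {D} in
lemma mem_ideal_of_factor {X Y Z : C} (hZ : D Z) (p : X ⟶ Z) (q : Z ⟶ Y) :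
    p ≫ q ∈ ideal D X Y :=
  AddSubgroup.subset_closure ⟨Z, hZ, p, q, rfl⟩

/-- A sum of two factorizations passes through the biproduct of the intermediate objects, so no sums
are needed. -/
lemma exists_factor_of_mem_ideal [HasBinaryBiproducts C] {X Y : C}
    (h₀ : ∃ Z, D Z) (h : ∀ ⦃Z W : C⦄, D Z → D W → D (Z ⊞ W))
    {f : X ⟶ Y} (hf : f ∈ ideal D X Y) : ∃ (Z : C) (_ : D Z) (p : X ⟶ Z) (q : Z ⟶ Y), p ≫ q = f := by
  induction hf using AddSubgroup.closure_induction with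
  | mem f hf => exact hf
  | zero =>
    obtain ⟨Z, hZ⟩ := h₀
    exact ⟨Z, hZ, 0, 0, by simp⟩
  | add f g _ _ hf hg =>
    obtain ⟨Z, hZ, p, q, rfl⟩ := hf
    obtain ⟨W, hW, r, s, rfl⟩ := hg
    exact ⟨_, h hZ hW, biprod.lift p r, biprod.desc q s, by simp⟩
  | neg f _ hf =>
    obtain ⟨Z, hZ, p, q, rfl⟩ := hf
    exact ⟨Z, hZ, -p, q, by simp⟩

lemma map_eq_zero_of_mem_ideal {E : Type*} [Category* E] [Preadditive E] (F : C ⥤ E) [F.Additive]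
    (h : ∀ X : C, D X → F.map (𝟙 X) = 0) {X Y : C} {f : X ⟶ Y} (hf : f ∈ ideal D X Y) :
    F.map f = 0 := by
  induction hf using AddSubgroup.closure_induction with
  | mem f hf =>
    obtain ⟨Z, hZ, p, q, rfl⟩ := hf
    rw [← Category.id_comp q, F.map_comp, F.map_comp, h Z hZ]
    simp
  | zero => simp
  | add f g _ _ hf hg => simp [F.map_add, hf, hg]
  | neg f _ hf => simp [F.map_neg, hf]

/-- Additivity of the induced functor is recorded because transporting modules along an equivalence
requires it. -/
lemma exists_equivalence {E : Type*} [Category* E] (F : C ⥤ E) [F.Full] [F.EssSurj]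
    (h : ∀ {X Y : C} (f g : X ⟶ Y), F.map f = F.map g ↔ f - g ∈ ideal D X Y) :
    ∃ e : IdealQuot D ≌ E, ∀ [Preadditive E] [F.Additive], e.functor.Additive := by
  let G : IdealQuot D ⥤ E := CategoryTheory.Quotient.lift (rel D) F fun _ _ f g hfg => (h f g).2 hfg
  have : G.Full := ⟨fun {X Y} f => by
    obtain ⟨g, hg⟩ := F.map_surjective f
    exact ⟨(CategoryTheory.Quotient.functor (rel D)).map g, hg⟩⟩
  have : G.Faithful := ⟨fun {X Y} f g hfg => by
    obtain ⟨f, rfl⟩ := (CategoryTheory.Quotient.functor (rel D)).map_surjective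
      (X := X.as) (Y := Y.as) f
    obtain ⟨g, rfl⟩ := (CategoryTheory.Quotient.functor (rel D)).map_surjective
      (X := X.as) (Y := Y.as) g
    exact CategoryTheory.Quotient.sound _ ((h f g).1 hfg)⟩
  have : G.EssSurj := ⟨fun Y => ⟨⟨F.objPreimage Y⟩, ⟨F.objObjPreimageIso Y⟩⟩⟩
  have : G.IsEquivalence := {}
  refine ⟨G.asEquivalence, fun {_ _} => ⟨fun {X Y f g} => ?_⟩⟩
  obtain ⟨f, rfl⟩ := (CategoryTheory.Quotient.functor (rel D)).map_surjective
    (X := X.as) (Y := Y.as) f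
  obtain ⟨g, rfl⟩ := (CategoryTheory.Quotient.functor (rel D)).map_surjective
    (X := X.as) (Y := Y.as) g
  exact F.map_add (f := f) (g := g)

variable {D} in
lemma mem_ideal_op_iff {X Y : Cᵒᵖ} (f : X ⟶ Y) :
    f ∈ ideal D.op X Y ↔ f.unop ∈ ideal D Y.unop X.unop := by
  constructor
  · intro hf
    induction hf using AddSubgroup.closure_induction with
    | mem f hf =>
      obtain ⟨Z, hZ, p, q, rfl⟩ := hf
      exact mem_ideal_of_factor (D := D) hZ q.unop p.unop
    | zero => exact (ideal D _ _).zero_mem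
    | add f g _ _ hf hg => exact (ideal D _ _).add_mem hf hg
    | neg f _ hf => exact (ideal D _ _).neg_mem hf
  · suffices ∀ g ∈ ideal D Y.unop X.unop, g.op ∈ ideal D.op X Y from this f.unop
    intro g hg
    induction hg using AddSubgroup.closure_induction with
    | mem f hf =>
      obtain ⟨Z, hZ, p, q, rfl⟩ := hf
      exact mem_ideal_of_factor (D := D.op) (Z := op Z) hZ q.op p.op
    | zero => exact (ideal D.op _ _).zero_mem
    | add f g _ _ hf hg => exact (ideal D.op _ _).add_mem hf hg
    | neg f _ hf => exact (ideal D.op _ _).neg_mem hf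

lemma nonempty_op_equivalence : Nonempty (IdealQuot D.op ≌ (IdealQuot D)ᵒᵖ) := by
  have : (CategoryTheory.Quotient.functor (rel D)).op.EssSurj :=
    ⟨fun X => ⟨op X.unop.as, ⟨Iso.refl _⟩⟩⟩
  refine (exists_equivalence D.op (CategoryTheory.Quotient.functor (rel D)).op
    fun f g => ?_).nonempty
  rw [mem_ideal_op_iff]
  exact Quiver.Hom.op_inj.eq_iff.trans
    (CategoryTheory.Quotient.functor_map_eq_iff (rel D) f.unop g.unop)

end

end IdealQuot

/-! ### The comparison criterion and change of the base category -/

section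

universe v₁ u₁

variable {A : Type u} [Category.{v} A] [Preadditive A]

/-- The common skeleton of both equivalences. The predicate `R` singles out the presentations that
come from triangles. Lifting maps of presentations to `C` is only asked for these, while density
accepts any presentation. -/
lemma nonempty_idealQuot_equivalence_FPMod {C : Type u₁} [Category.{v₁} C] [Preadditive C]
    (D : ObjectProperty C) (H : C ⥤ Aᵒᵖ ⥤ AddCommGrpCat.{v}) [H.Additive]
    [∀ X, (H.obj X).Additive]
    (hker : ∀ {X Y : C} (f : X ⟶ Y), H.map f = 0 ↔ f ∈ IdealQuot.ideal D X Y)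
    (R : ∀ (X : C) {a b : A} (_ : a ⟶ b) (_ : (H.obj X).obj (op b)), Prop)
    (hR : ∀ {X : C} {a b : A} {f : a ⟶ b} {η : (H.obj X).obj (op b)}, R X f η →
      IsPresentation (H.obj X) f η)
    (hex : ∀ X : C, ∃ (a b : A) (f : a ⟶ b) (η : (H.obj X).obj (op b)), R X f η)
    (hfull : ∀ {X X' : C} {a b a' b' : A} {f : a ⟶ b} {η : (H.obj X).obj (op b)} {f' : a' ⟶ b'}
      {η' : (H.obj X').obj (op b')}, R X f η → R X' f' η' → ∀ (α : a ⟶ a') (β : b ⟶ b'),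
      f ≫ β = α ≫ f' → ∃ t : X ⟶ X', (H.map t).app (op b) η = (H.obj X').map β.op η')
    (hsurj : ∀ {a b : A} (f : a ⟶ b), ∃ (X : C) (η : (H.obj X).obj (op b)),
      IsPresentation (H.obj X) f η) :
    Nonempty (IdealQuot D ≌ FPMod A) := by
  have hfp (X : C) : IsFPModule A (H.obj X) := by
    obtain ⟨a, b, f, η, h⟩ := hex X
    exact (isFPModule_iff _).2 ⟨inferInstance, a, b, f, η, hR h⟩
  have : H.Full := ⟨fun {X X'} φ => by
    obtain ⟨a, b, f, η, h⟩ := hex X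
    obtain ⟨a', b', f', η', h'⟩ := hex X'
    obtain ⟨β, hβ⟩ := (hR h').exists_map_eq b (φ.app _ η)
    obtain ⟨α, hα⟩ := (hR h').exists_comp_eq a (f ≫ β) (by
      rw [map_op_comp_apply, hβ, ← NatTrans.naturality_apply, (hR h).map_eq_zero, map_zero])
    obtain ⟨t, ht⟩ := hfull h h' α β hα.symm
    exact ⟨t, (hR h).hom_ext (ht.trans hβ)⟩⟩
  let F : C ⥤ FPMod A := ObjectProperty.lift _ H hfp
  have : F.EssSurj := ⟨fun G => by
    obtain ⟨hG, a, b, f, η, h⟩ := (isFPModule_iff _).1 G.property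
    obtain ⟨X, η', h'⟩ := hsurj f
    obtain ⟨e⟩ := h'.nonempty_iso h
    exact ⟨X, ⟨ObjectProperty.isoMk _ e⟩⟩⟩
  refine (IdealQuot.exists_equivalence D F fun f g => ?_).nonempty
  rw [← hker, H.map_sub, sub_eq_zero]
  exact ⟨fun h => congr_arg (fun k => k.hom) h, fun h => ObjectProperty.hom_ext _ h⟩

lemma IsFPModule.of_iso {G G' : Aᵒᵖ ⥤ AddCommGrpCat.{v}} (e : G ≅ G') (hG : IsFPModule A G) :
    IsFPModule A G' := by
  obtain ⟨hG, X, Y, f, p, h, hex, hp⟩ := hG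
  have := hG
  refine ⟨Functor.additive_of_iso e, X, Y, f, p ≫ e.hom, by rw [reassoc_of% h, zero_comp], ?_,
    inferInstance⟩
  refine ShortComplex.exact_of_iso ?_ hex
  exact (ShortComplex.isoMk (Iso.refl _) (Iso.refl _) e)

/-- The same element `η` presents `G` over the image of `f`; the other objects of `B` are reached
through preimages under the equivalence. -/
lemma IsFPModule.of_comp_equivalence {B : Type u} [Category.{v} B] [Preadditive B] (e : A ≌ B)
    [e.functor.Additive] {G : Bᵒᵖ ⥤ AddCommGrpCat.{v}} (hG : IsFPModule A (e.functor.op ⋙ G)) :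
    IsFPModule B G := by
  obtain ⟨hadd, a, b, f, η, h⟩ := (isFPModule_iff _).1 hG
  have i : e.inverse.op ⋙ e.functor.op ⋙ G ≅ G :=
    (Functor.associator _ _ _).symm ≪≫ Functor.isoWhiskerRight (NatIso.op e.counitIso.symm) G ≪≫
      G.leftUnitor
  refine (isFPModule_iff _).2 ⟨Functor.additive_of_iso i, _, _, e.functor.map f, η, ?_, ?_, ?_⟩
  · exact h.map_eq_zero
  · intro c ξ
    let j := e.functor.objObjPreimageIso c
    obtain ⟨g, hg⟩ := h.exists_map_eq (e.functor.objPreimage c) (G.map j.hom.op ξ)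
    refine ⟨j.inv ≫ e.functor.map g, ?_⟩
    rw [map_op_comp_apply]
    refine (congr_arg _ hg).trans ?_
    rw [← map_op_comp_apply]
    simp
  · intro c g hg
    let j := e.functor.objObjPreimageIso c
    obtain ⟨k, hk⟩ := e.functor.map_surjective (j.hom ≫ g)
    obtain ⟨t, rfl⟩ := h.exists_comp_eq _ k (by
      change G.map (e.functor.map k).op η = 0
      rw [hk, map_op_comp_apply, hg, map_zero])
    refine ⟨j.inv ≫ e.functor.map t, ?_⟩
    rw [Category.assoc, ← e.functor.map_comp, hk]
    simp

lemma nonempty_FPMod_equivalence {B : Type u} [Category.{v} B] [Preadditive B] (e : A ≌ B)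
    [e.functor.Additive] : Nonempty (FPMod A ≌ FPMod B) := by
  let W := (Functor.whiskeringLeft _ _ AddCommGrpCat.{v}).obj e.inverse.op
  have hW : ∀ G : FPMod A, IsFPModule B (W.obj G.obj) := fun G => by
    refine IsFPModule.of_comp_equivalence e (G.property.of_iso ?_)
    exact G.obj.leftUnitor.symm ≪≫ Functor.isoWhiskerRight (NatIso.op e.unitIso.symm) G.obj
  let F : FPMod A ⥤ FPMod B := ObjectProperty.lift _ (ObjectProperty.ι _ ⋙ W) hW
  have : F.EssSurj := ⟨fun G => by
    obtain ⟨G', ⟨i⟩⟩ : ∃ G', Nonempty (W.obj G' ≅ G.obj) := ⟨_, ⟨W.objObjPreimageIso _⟩⟩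
    have : e.symm.functor.Additive := e.inverse_additive
    exact ⟨⟨G', IsFPModule.of_comp_equivalence e.symm (G.property.of_iso i.symm)⟩,
      ⟨ObjectProperty.isoMk _ i⟩⟩⟩
  have : F.IsEquivalence := {}
  exact ⟨F.asEquivalence⟩

end

/-! ### Restricted Yoneda functor on a quotient of a full subcategory -/

namespace IdealQuot

variable {C : Type u} [Category.{v} C] [Preadditive C] (M D : ObjectProperty C)

/-- The projection of a full subcategory `M` onto `M/[D]`. -/
abbrev subFunctor : M.FullSubcategory ⥤ sub M D :=
  CategoryTheory.Quotient.functor (rel (D.inverseImage M.ι))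

variable {M D}

lemma hom_mem_ideal {X Y : M.FullSubcategory} {f : X ⟶ Y}
    (hf : f ∈ ideal (D.inverseImage M.ι) X Y) : f.hom ∈ ideal D X.obj Y.obj := by
  induction hf using AddSubgroup.closure_induction with
  | mem f hf =>
    obtain ⟨Z, hZ, p, q, rfl⟩ := hf
    exact mem_ideal_of_factor (D := D) hZ p.hom q.hom
  | zero => exact (ideal D _ _).zero_mem
  | add f g _ _ hf hg => exact (ideal D _ _).add_mem hf hg
  | neg f _ hf => exact (ideal D _ _).neg_mem hf

lemma homMk_mem_ideal (hD : D ≤ M) {X Y : M.FullSubcategory} {f : X.obj ⟶ Y.obj}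
    (hf : f ∈ ideal D X.obj Y.obj) : ObjectProperty.homMk f ∈ ideal (D.inverseImage M.ι) X Y := by
  induction hf using AddSubgroup.closure_induction with
  | mem f hf =>
    obtain ⟨Z, hZ, p, q, rfl⟩ := hf
    let Z' : M.FullSubcategory := ⟨Z, hD Z hZ⟩
    exact mem_ideal_of_factor (D := D.inverseImage M.ι) (Z := Z') hZ
      (ObjectProperty.homMk p) (ObjectProperty.homMk q)
  | zero => exact (ideal _ _ _).zero_mem
  | add f g _ _ hf hg => exact (ideal _ _ _).add_mem hf hg
  | neg f _ hf => exact (ideal _ _ _).neg_mem hf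

lemma subFunctor_map_eq_iff (hD : D ≤ M) {X Y : M.FullSubcategory} (f g : X ⟶ Y) :
    (subFunctor M D).map f = (subFunctor M D).map g ↔ f.hom - g.hom ∈ ideal D X.obj Y.obj := by
  rw [CategoryTheory.Quotient.functor_map_eq_iff]
  exact ⟨fun h => hom_mem_ideal h, fun h => homMk_mem_ideal hD h⟩

variable (M D)

/-- The functor `M/[D] ⥤ C/[D]`. -/
def subToQuot : sub M D ⥤ IdealQuot D :=
  CategoryTheory.Quotient.lift _ (M.ι ⋙ CategoryTheory.Quotient.functor (rel D))
    fun _ _ _ _ h => CategoryTheory.Quotient.sound _ (hom_mem_ideal h)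

instance : (subToQuot M D).Additive where
  map_add {X Y f g} := by
    obtain ⟨f, rfl⟩ := (subFunctor M D).map_surjective (X := X.as) (Y := Y.as) f
    obtain ⟨g, rfl⟩ := (subFunctor M D).map_surjective (X := X.as) (Y := Y.as) g
    rfl

/-- The functor `X ↦ (C/[D])(-, X)`, restricted to `M/[D]`. -/
def restrictedYoneda : C ⥤ (sub M D)ᵒᵖ ⥤ AddCommGrpCat.{v} :=
  CategoryTheory.Quotient.functor (rel D) ⋙ preadditiveYoneda ⋙
    (Functor.whiskeringLeft _ _ _).obj (subToQuot M D).op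

instance : (restrictedYoneda M D).Additive where
  map_add {X Y f g} := by
    ext c ξ
    exact Preadditive.comp_add _ _ _ ξ ((CategoryTheory.Quotient.functor (rel D)).map f)
      ((CategoryTheory.Quotient.functor (rel D)).map g)

instance (X : C) : ((restrictedYoneda M D).obj X).Additive :=
  inferInstanceAs ((subToQuot M D).op ⋙ preadditiveYoneda.obj _).Additive

variable {M D}

/-- The element of `(C/[D])(m, X)` given by a morphism in `C`. -/
def yonedaMk {m : M.FullSubcategory} {X : C} (y : m.obj ⟶ X) :
    ((restrictedYoneda M D).obj X).obj (op ⟨m⟩) :=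
  (CategoryTheory.Quotient.functor (rel D)).map y

lemma yonedaMk_surjective {m : M.FullSubcategory} {X : C}
    (ξ : ((restrictedYoneda M D).obj X).obj (op ⟨m⟩)) : ∃ y : m.obj ⟶ X, yonedaMk y = ξ :=
  (CategoryTheory.Quotient.functor (rel D)).map_surjective (X := m.obj) (Y := X) ξ

lemma yonedaMk_eq_iff {m : M.FullSubcategory} {X : C} (y y' : m.obj ⟶ X) :
    yonedaMk (D := D) y = yonedaMk y' ↔ y - y' ∈ ideal D _ _ :=
  CategoryTheory.Quotient.functor_map_eq_iff _ _ _

lemma yonedaMk_eq_zero_iff {m : M.FullSubcategory} {X : C} (y : m.obj ⟶ X) :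
    yonedaMk (D := D) y = 0 ↔ y ∈ ideal D _ _ :=
  functor_map_eq_zero_iff D y

lemma map_yonedaMk {m m' : M.FullSubcategory} (g : m ⟶ m') {X : C} (y : m'.obj ⟶ X) :
    ((restrictedYoneda M D).obj X).map ((subFunctor M D).map g).op (yonedaMk y) =
      yonedaMk (g.hom ≫ y) := rfl

lemma app_yonedaMk {m : M.FullSubcategory} {X X' : C} (y : m.obj ⟶ X) (t : X ⟶ X') :
    ((restrictedYoneda M D).map t).app (op ⟨m⟩) (yonedaMk y) = yonedaMk (y ≫ t) := rfl

lemma isPresentation_restrictedYoneda (hD : D ≤ M) {m₁ m₀ : M.FullSubcategory} (f : m₁ ⟶ m₀)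
    {X : C} (y : m₀.obj ⟶ X) (h₁ : f.hom ≫ y ∈ ideal D _ _)
    (h₂ : ∀ (m : C), M m → ∀ g : m ⟶ X, ∃ g' : m ⟶ m₀.obj, g' ≫ y - g ∈ ideal D _ _)
    (h₃ : ∀ (m : C), M m → ∀ g : m ⟶ m₀.obj, g ≫ y ∈ ideal D _ _ →
      ∃ k : m ⟶ m₁.obj, k ≫ f.hom - g ∈ ideal D _ _) :
    IsPresentation ((restrictedYoneda M D).obj X) ((subFunctor M D).map f) (yonedaMk y) where
  map_eq_zero := by rwa [map_yonedaMk, yonedaMk_eq_zero_iff]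
  exists_map_eq := by
    rintro ⟨c⟩ ξ
    obtain ⟨g, rfl⟩ := yonedaMk_surjective ξ
    obtain ⟨g', hg⟩ := h₂ c.obj c.property g
    refine ⟨(subFunctor M D).map (ObjectProperty.homMk g'), ?_⟩
    rwa [map_yonedaMk, yonedaMk_eq_iff]
  exists_comp_eq := by
    rintro ⟨c⟩ g hg
    obtain ⟨g, rfl⟩ := (subFunctor M D).map_surjective (X := c) g
    rw [map_yonedaMk, yonedaMk_eq_zero_iff] at hg
    obtain ⟨k, hk⟩ := h₃ c.obj c.property g.hom hg
    refine ⟨(subFunctor M D).map (ObjectProperty.homMk k), ?_⟩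
    rw [← Functor.map_comp]
    exact (subFunctor_map_eq_iff hD _ _).2 hk

end IdealQuot

/-! ### The equivalence out of `𝒞/[Σ M]` -/

namespace Extriangulation.IsClusterTilting

open PreExtriangulation IdealQuot ZeroObject

variable {𝒞 : Type u} [Category.{v} 𝒞] [Preadditive 𝒞] [HasBinaryBiproducts 𝒞] [HasZeroObject 𝒞]
  {𝓔 : Extriangulation.{w} 𝒞} {M : ObjectProperty 𝒞} (hM : 𝓔.IsClusterTilting M)

lemma exists_factor_inj {X Y : 𝒞} {f : X ⟶ Y} (hf : f ∈ ideal 𝓔.inj X Y) :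
    ∃ (Z : 𝒞) (_ : 𝓔.inj Z) (p : X ⟶ Z) (q : Z ⟶ Y), p ≫ q = f :=
  exists_factor_of_mem_ideal 𝓔.inj ⟨0, fun _ _ _ _ _ => ⟨0, (isZero_zero 𝒞).eq_of_tgt _ _⟩⟩
    (fun _ _ => inj_biprod) hf

lemma exists_factor_proj {X Y : 𝒞} {f : X ⟶ Y} (hf : f ∈ ideal 𝓔.proj X Y) :
    ∃ (Z : 𝒞) (_ : 𝓔.proj Z) (p : X ⟶ Z) (q : Z ⟶ Y), p ≫ q = f :=
  exists_factor_of_mem_ideal 𝓔.proj ⟨0, fun _ _ _ _ _ => ⟨0, (isZero_zero 𝒞).eq_of_src _ _⟩⟩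
    (fun _ _ => proj_biprod) hf

include hM

omit [HasZeroObject 𝒞] in
lemma exists_lift {A B X m : 𝒞} {x : A ⟶ B} {y : B ⟶ X} {δ : 𝓔.Ext X A} (h : 𝓔.IsTriangle x y δ)
    (hA : M A) (hm : M m) (g : m ⟶ X) : ∃ g' : m ⟶ B, g' ≫ y = g :=
  exists_lift_of_pull_eq_zero h g (hM.ext_eq_zero hm hA _)

lemma isPresentation_of_isTriangle {m₁ m₀ : M.FullSubcategory} (f : m₁ ⟶ m₀) {X : 𝒞}
    {y : m₀.obj ⟶ X} {δ : 𝓔.Ext X m₁.obj} (h : 𝓔.IsTriangle f.hom y δ) :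
    IsPresentation ((restrictedYoneda M 𝓔.inj).obj X) ((subFunctor M 𝓔.inj).map f)
      (yonedaMk y) := by
  refine isPresentation_restrictedYoneda hM.inj_le f y ?_ (fun m hm g => ?_) (fun m hm g hg => ?_)
  · rw [comp_eq_zero h]
    exact (ideal _ _ _).zero_mem
  · obtain ⟨g', rfl⟩ := hM.exists_lift h m₁.property hm g
    exact ⟨g', by simp⟩
  · obtain ⟨I, hI, u, v, huv⟩ := exists_factor_inj hg
    -- Injectives lie in `M`, so `v` lifts along `y`. Subtracting `u ≫ v'` does not change `g`
    -- modulo `[ℐ]` and makes its composite with `y` vanish.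
    obtain ⟨v', rfl⟩ := hM.exists_lift h m₁.property (hM.inj_le _ hI) v
    obtain ⟨k, hk⟩ := exists_factor_left h (g - u ≫ v') (by simp [← huv])
    exact ⟨k, by
      rw [hk, sub_sub_cancel_left]
      exact (ideal _ _ _).neg_mem (mem_ideal_of_factor hI _ _)⟩

/-- A morphism induces zero on `(𝒞/[ℐ])(M, -)` if and only if it lies in `[Σ M]`. -/
lemma restrictedYoneda_map_eq_zero_iff (hP : 𝓔.EnoughProj) (hI : 𝓔.EnoughInj) {X Y : 𝒞}
    (f : X ⟶ Y) :
    (restrictedYoneda M 𝓔.inj).map f = 0 ↔ f ∈ ideal (𝓔.cosyzygy M) X Y := by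
  constructor
  · intro hf
    obtain ⟨m₁, m₀, x, y, δ, h₁, h₀, h⟩ := hM.exists_isTriangle_right hP X
    let m : M.FullSubcategory := ⟨m₀, h₀⟩
    have hy := ConcreteCategory.congr_hom (NatTrans.congr_app hf (Opposite.op ⟨m⟩))
      (yonedaMk (m := m) y)
    rw [app_yonedaMk] at hy
    obtain ⟨I, hI', u, v, huv⟩ := exists_factor_inj ((yonedaMk_eq_zero_iff _).1 hy)
    obtain ⟨J, L, j, p, lam, hJ, hj⟩ := hI m₀
    -- The map `u` is enlarged to an inflation `(u, j)` into `I ⊞ J`. The weak pushout `Z` is then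
    -- the cone of an inflation `m₁ ⟶ I ⊞ J`, hence in `Σ M`.
    obtain ⟨Z, z, d, δ', hz, H⟩ := exists_weak_pushout h (isInflation_lift u ⟨L, p, lam, hj⟩)
    obtain ⟨k, rfl⟩ := H f (biprod.desc v 0) (by simp [huv])
    exact mem_ideal_of_factor ⟨m₁, _, _, z, δ', h₁, inj_biprod hI' hJ, hz⟩ d k
  · refine map_eq_zero_of_mem_ideal _ _ fun Z hZ => ?_
    obtain ⟨m₁, I, x, y, δ, h₁, hI, h⟩ := hZ
    ext ⟨⟨c⟩⟩ ξ
    obtain ⟨g, rfl⟩ := yonedaMk_surjective ξ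
    -- Every morphism from `M` to an object of `Σ M` lifts to the injective middle term, so it is
    -- zero modulo `[ℐ]`.
    obtain ⟨g', rfl⟩ := hM.exists_lift h h₁ c.property g
    rw [app_yonedaMk]
    exact (yonedaMk_eq_zero_iff _).2 (by
      simpa using mem_ideal_of_factor hI g' y)

theorem nonempty_equivalence_cosyzygy (hP : 𝓔.EnoughProj) (hI : 𝓔.EnoughInj) :
    Nonempty (IdealQuot (𝓔.cosyzygy M) ≌ FPMod (sub M 𝓔.inj)) := by
  refine nonempty_idealQuot_equivalence_FPMod _ (restrictedYoneda M 𝓔.inj)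
    (fun f => hM.restrictedYoneda_map_eq_zero_iff hP hI f)
    (fun X {a b} f η => ∃ (f' : a.as ⟶ b.as) (y : b.as.obj ⟶ X) (δ : 𝓔.Ext X a.as.obj),
      𝓔.IsTriangle f'.hom y δ ∧ f = (subFunctor M 𝓔.inj).map f' ∧ η = yonedaMk y)
    ?_ ?_ ?_ ?_
  · rintro X a b _ _ ⟨f, y, δ, h, rfl, rfl⟩
    exact hM.isPresentation_of_isTriangle f h
  · intro X
    obtain ⟨m₁, m₀, x, y, δ, h₁, h₀, h⟩ := hM.exists_isTriangle_right hP X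
    exact ⟨⟨⟨m₁, h₁⟩⟩, ⟨⟨m₀, h₀⟩⟩, _, _, ObjectProperty.homMk x, y, δ, h, rfl, rfl⟩
  · rintro X X' a b a' b' _ _ _ _ ⟨f, y, δ, h, rfl, rfl⟩ ⟨f', y', δ', h', rfl, rfl⟩ α β hαβ
    obtain ⟨α, rfl⟩ := (subFunctor M 𝓔.inj).map_surjective (X := a.as) (Y := a'.as) α
    obtain ⟨β, rfl⟩ := (subFunctor M 𝓔.inj).map_surjective (X := b.as) (Y := b'.as) β
    have hαβ' := (subFunctor_map_eq_iff hM.inj_le (f ≫ β) (α ≫ f')).1 hαβ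
    obtain ⟨I, hI, u, v, huv⟩ := exists_factor_inj hαβ'
    -- The defect of the square factors through an injective, so it extends along the inflation `f`.
    -- Subtracting `u' ≫ v` from `β` makes the square commute strictly.
    obtain ⟨u', rfl⟩ := hI f.hom ⟨_, _, _, h⟩ u
    obtain ⟨t, ht, -⟩ := 𝓔.et3 h h' α.hom (β.hom - u' ≫ v) (by
      rw [Preadditive.comp_sub, ← Category.assoc, huv]
      simp)
    refine ⟨t, ?_⟩
    rw [app_yonedaMk]
    refine Eq.trans ?_ (map_yonedaMk β y').symm
    rw [yonedaMk_eq_iff, ht, Preadditive.sub_comp, sub_sub_cancel_left, Category.assoc]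
    exact (ideal _ _ _).neg_mem (mem_ideal_of_factor hI _ _)
  · rintro a b f
    obtain ⟨f, rfl⟩ := (subFunctor M 𝓔.inj).map_surjective (X := a.as) (Y := b.as) f
    obtain ⟨I, L, i, q, lam, hI, hi⟩ := hI a.as.obj
    obtain ⟨X, p, δ, h⟩ := isInflation_lift f.hom ⟨L, q, lam, hi⟩
    have hp := comp_eq_zero h
    -- The triangle is `a ⟶ b ⊞ I ⟶ X`. Modulo `[ℐ]` the summand `I` disappears, leaving `f` as a
    -- presentation.
    refine ⟨X, yonedaMk (biprod.inl ≫ p), isPresentation_restrictedYoneda hM.inj_le f _ ?_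
      (fun m hm g => ?_) (fun m hm g hg => ?_)⟩
    · have : f.hom ≫ biprod.inl ≫ p = (-i) ≫ biprod.inr ≫ p := by
        rw [← sub_eq_zero, ← hp]
        simp [biprod.lift_eq]
      rw [this]
      exact mem_ideal_of_factor hI _ _
    · obtain ⟨g', rfl⟩ := hM.exists_lift h a.as.property hm g
      refine ⟨g' ≫ biprod.fst, ?_⟩
      have : (g' ≫ biprod.fst) ≫ biprod.inl ≫ p - g' ≫ p =
          (-(g' ≫ biprod.snd)) ≫ biprod.inr ≫ p := by
        have := g' ≫= biprod.total =≫ p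
        simp only [Preadditive.comp_add, Preadditive.add_comp, Category.assoc,
          Category.id_comp] at this
        rw [← this]
        simp
      rw [this]
      exact mem_ideal_of_factor hI _ _
    · obtain ⟨J, hJ, u, v, huv⟩ := exists_factor_inj hg
      obtain ⟨v', rfl⟩ := hM.exists_lift h a.as.property (hM.inj_le _ hJ) v
      obtain ⟨k, hk⟩ := exists_factor_left h (g ≫ biprod.inl - u ≫ v') (by simp [huv])
      refine ⟨k, ?_⟩
      have : k ≫ f.hom - g = (-u) ≫ v' ≫ biprod.fst := by
        have := hk =≫ biprod.fst
        simp only [Category.assoc, biprod.lift_fst, Preadditive.sub_comp, biprod.inl_fst,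
          Category.comp_id] at this
        rw [this]
        simp
      rw [this]
      exact mem_ideal_of_factor hJ _ _

end Extriangulation.IsClusterTilting

/-! ### The equivalence out of `𝒞/[M]` -/

namespace Extriangulation

open PreExtriangulation IdealQuot

variable {𝒞 : Type u} [Category.{v} 𝒞] [Preadditive 𝒞] [HasBinaryBiproducts 𝒞]
  (𝓔 : Extriangulation.{w} 𝒞) [∀ C A : 𝒞, Small.{v} (𝓔.Ext C A)]

/-- `𝔼` with values in the universe of the morphisms of `𝒞`. -/
def smallExt : 𝒞ᵒᵖ ⥤ 𝒞 ⥤ AddCommGrpCat.{v} where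
  obj C :=
    { obj := fun A => AddCommGrpCat.of (Shrink.{v} (𝓔.Ext C.unop A))
      map := fun {A A'} a => AddCommGrpCat.ofHom (AddMonoidHom.mk'
        (fun δ => equivShrink _ (push a ((equivShrink _).symm δ)))
        fun δ ε => by rw [equivShrink_symm_add, push_add, equivShrink_add])
      map_id := fun A => by ext δ; simp
      map_comp := fun a a' => by ext δ; simp [push_comp] }
  map {C C'} c :=
    { app := fun A => AddCommGrpCat.ofHom (AddMonoidHom.mk'
        (fun δ => equivShrink _ (pull c.unop ((equivShrink _).symm δ)))
        fun δ ε => by rw [equivShrink_symm_add, pull_add, equivShrink_add])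
      naturality := fun A A' a => by ext δ; simp [push_pull] }
  map_id C := by ext A δ; simp
  map_comp c c' := by ext A δ; simp [pull_comp]

instance : 𝓔.smallExt.Additive where
  map_add {C C' c c'} := by
    ext A δ
    exact (congr_arg (equivShrink _) (add_pull _ _ _)).trans (equivShrink_add _ _)

instance (C : 𝒞ᵒᵖ) : (𝓔.smallExt.obj C).Additive where
  map_add {A A' a a'} := by
    ext δ
    exact (congr_arg (equivShrink _) (add_push _ _ _)).trans (equivShrink_add _ _)

variable [HasZeroObject 𝒞] (M : ObjectProperty 𝒞)

/-- This makes `𝔼(-, A)` well defined on `M/[𝒫]`: the identity of a projective acts as zero because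
its extension groups vanish. -/
lemma smallExt_rightOp_map_eq {X Y : 𝒞} {f g : X ⟶ Y} (h : f - g ∈ ideal 𝓔.proj X Y) :
    𝓔.smallExt.rightOp.map f = 𝓔.smallExt.rightOp.map g := by
  have : 𝓔.smallExt.rightOp.Additive :=
    ⟨fun {_ _ a b} => congr_arg Quiver.Hom.op (𝓔.smallExt.map_add (f := a.op) (g := b.op))⟩
  rw [← sub_eq_zero, ← Functor.map_sub]
  refine map_eq_zero_of_mem_ideal _ _ (fun P hP => Quiver.Hom.unop_inj ?_) h
  ext A δ
  have : Subsingleton (𝓔.Ext P A) :=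
    ⟨fun ε ε' => by rw [ext_eq_zero_of_proj hP ε, ext_eq_zero_of_proj hP ε']⟩
  have := (equivShrink.{v} (𝓔.Ext P A)).symm.subsingleton
  exact Subsingleton.elim (α := Shrink.{v} (𝓔.Ext P A)) _ _

/-- The functor `X ↦ 𝔼(-, X)`, restricted to `M/[𝒫]`. -/
def restrictedExt : 𝒞 ⥤ (sub M 𝓔.proj)ᵒᵖ ⥤ AddCommGrpCat.{v} :=
  (CategoryTheory.Quotient.lift (rel (𝓔.proj.inverseImage M.ι)) (M.ι ⋙ 𝓔.smallExt.rightOp)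
    fun _ _ _ _ h => 𝓔.smallExt_rightOp_map_eq (hom_mem_ideal h)).leftOp.flip

variable {𝓔 M}

/-- The element of the restriction of `𝔼(-, X)` given by an extension. -/
def extMk {m : M.FullSubcategory} {X : 𝒞} (δ : 𝓔.Ext m.obj X) :
    ((𝓔.restrictedExt M).obj X).obj (Opposite.op ⟨m⟩) :=
  equivShrink.{v} _ δ

lemma extMk_surjective {m : M.FullSubcategory} {X : 𝒞}
    (ξ : ((𝓔.restrictedExt M).obj X).obj (Opposite.op ⟨m⟩)) :
    ∃ δ : 𝓔.Ext m.obj X, extMk δ = ξ :=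
  (equivShrink.{v} (𝓔.Ext m.obj X)).surjective ξ

lemma extMk_injective {m : M.FullSubcategory} {X : 𝒞} {δ ε : 𝓔.Ext m.obj X}
    (h : extMk δ = extMk ε) : δ = ε :=
  (equivShrink.{v} (𝓔.Ext m.obj X)).injective h

@[simp]
lemma extMk_zero (m : M.FullSubcategory) (X : 𝒞) : extMk (0 : 𝓔.Ext m.obj X) = 0 :=
  (Shrink.addEquiv (α := 𝓔.Ext m.obj X)).symm.map_zero

lemma extMk_add {m : M.FullSubcategory} {X : 𝒞} (δ ε : 𝓔.Ext m.obj X) :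
    extMk (δ + ε) = extMk δ + extMk ε :=
  equivShrink_add _ _

lemma map_extMk {m m' : M.FullSubcategory} (g : m ⟶ m') {X : 𝒞} (δ : 𝓔.Ext m'.obj X) :
    ((𝓔.restrictedExt M).obj X).map ((subFunctor M 𝓔.proj).map g).op (extMk δ) =
      extMk (pull g.hom δ) :=
  congr_arg (fun ε => equivShrink.{v} _ (pull g.hom ε)) ((equivShrink.{v} _).symm_apply_apply δ)

lemma app_extMk {m : M.FullSubcategory} {X X' : 𝒞} (δ : 𝓔.Ext m.obj X) (t : X ⟶ X') :
    ((𝓔.restrictedExt M).map t).app (Opposite.op ⟨m⟩) (extMk δ) = extMk (push t δ) :=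
  congr_arg (fun ε => equivShrink.{v} _ (push t ε)) ((equivShrink.{v} _).symm_apply_apply δ)

instance : (𝓔.restrictedExt M).Additive where
  map_add {X Y f g} := by
    ext ⟨⟨m⟩⟩ ξ
    obtain ⟨δ, rfl⟩ := extMk_surjective ξ
    change _ = ((𝓔.restrictedExt M).map f).app (Opposite.op ⟨m⟩) (extMk δ) +
      ((𝓔.restrictedExt M).map g).app (Opposite.op ⟨m⟩) (extMk δ)
    rw [app_extMk, app_extMk, app_extMk, add_push, extMk_add]

instance (X : 𝒞) : ((𝓔.restrictedExt M).obj X).Additive where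
  map_add := by
    rintro ⟨⟨m⟩⟩ ⟨⟨m'⟩⟩ f g
    obtain ⟨f', hf⟩ := (subFunctor M 𝓔.proj).map_surjective (X := m') (Y := m) f.unop
    obtain ⟨g', hg⟩ := (subFunctor M 𝓔.proj).map_surjective (X := m') (Y := m) g.unop
    obtain rfl := Quiver.Hom.unop_inj (a₁ := ((subFunctor M 𝓔.proj).map f').op) hf
    obtain rfl := Quiver.Hom.unop_inj (a₁ := ((subFunctor M 𝓔.proj).map g').op) hg
    ext ξ
    obtain ⟨δ, rfl⟩ := extMk_surjective ξ
    change _ = ((𝓔.restrictedExt M).obj X).map ((subFunctor M 𝓔.proj).map f').op (extMk δ) +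
      ((𝓔.restrictedExt M).obj X).map ((subFunctor M 𝓔.proj).map g').op (extMk δ)
    rw [← op_add, ← Functor.map_add, map_extMk, map_extMk, map_extMk, ← extMk_add, ← add_pull]
    rfl

namespace IsClusterTilting

variable (hM : 𝓔.IsClusterTilting M)

include hM

lemma isPresentation_restrictedExt {m₀ m₁ : M.FullSubcategory} (f : m₀ ⟶ m₁) {X : 𝒞}
    (δ : 𝓔.Ext m₁.obj X) (h₁ : pull f.hom δ = 0)
    (h₂ : ∀ (m : 𝒞), M m → ∀ ε : 𝓔.Ext m X, ∃ g : m ⟶ m₁.obj, pull g δ = ε)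
    (h₃ : ∀ (m : 𝒞), M m → ∀ g : m ⟶ m₁.obj, pull g δ = 0 →
      ∃ k : m ⟶ m₀.obj, k ≫ f.hom - g ∈ ideal 𝓔.proj _ _) :
    IsPresentation ((𝓔.restrictedExt M).obj X) ((subFunctor M 𝓔.proj).map f) (extMk δ) where
  map_eq_zero := by rw [map_extMk, h₁, extMk_zero]
  exists_map_eq := by
    rintro ⟨c⟩ ξ
    obtain ⟨ε, rfl⟩ := extMk_surjective ξ
    obtain ⟨g, rfl⟩ := h₂ c.obj c.property ε
    exact ⟨(subFunctor M 𝓔.proj).map (ObjectProperty.homMk g), map_extMk _ _⟩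
  exists_comp_eq := by
    rintro ⟨c⟩ g hg
    obtain ⟨g, rfl⟩ := (subFunctor M 𝓔.proj).map_surjective (X := c) g
    rw [map_extMk, ← extMk_zero] at hg
    obtain ⟨k, hk⟩ := h₃ c.obj c.property g.hom (extMk_injective hg)
    refine ⟨(subFunctor M 𝓔.proj).map (ObjectProperty.homMk k), ?_⟩
    rw [← Functor.map_comp]
    exact (subFunctor_map_eq_iff hM.proj_le _ _).2 hk

lemma restrictedExt_map_eq_zero_iff (hI : 𝓔.EnoughInj) {X Y : 𝒞} (f : X ⟶ Y) :
    (𝓔.restrictedExt M).map f = 0 ↔ f ∈ ideal M X Y := by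
  constructor
  · intro hf
    obtain ⟨m₀, m₁, x, y, δ, h₀, h₁, h⟩ := hM.exists_isTriangle_left hI X
    let m : M.FullSubcategory := ⟨m₁, h₁⟩
    have hδ := ConcreteCategory.congr_hom (NatTrans.congr_app hf (Opposite.op ⟨m⟩))
      (extMk (m := m) δ)
    rw [app_extMk] at hδ
    -- Vanishing on the single universal extension `δ ∈ 𝔼(m₁, X)` already forces `f` to extend over
    -- `m₀ ∈ M`.
    obtain ⟨k, rfl⟩ := exists_extend_of_push_eq_zero h f
      (extMk_injective (hδ.trans (extMk_zero m Y).symm))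
    exact mem_ideal_of_factor h₀ x k
  · refine map_eq_zero_of_mem_ideal _ _ fun Z hZ => ?_
    ext ⟨⟨c⟩⟩ ξ
    obtain ⟨δ, rfl⟩ := extMk_surjective ξ
    rw [hM.ext_eq_zero c.property hZ δ, extMk_zero, map_zero, map_zero]

theorem nonempty_equivalence_idealQuot (hP : 𝓔.EnoughProj) (hI : 𝓔.EnoughInj) :
    Nonempty (IdealQuot M ≌ FPMod (sub M 𝓔.proj)) := by
  refine nonempty_idealQuot_equivalence_FPMod _ (𝓔.restrictedExt M)
    (fun f => hM.restrictedExt_map_eq_zero_iff hI f)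
    (fun X {a b} f η => ∃ (x : X ⟶ a.as.obj) (f' : a.as ⟶ b.as) (δ : 𝓔.Ext b.as.obj X),
      𝓔.IsTriangle x f'.hom δ ∧ f = (subFunctor M 𝓔.proj).map f' ∧ η = extMk δ)
    ?_ ?_ ?_ ?_
  · rintro X a b _ _ ⟨x, f, δ, h, rfl, rfl⟩
    refine hM.isPresentation_restrictedExt f δ (pull_eq_zero h) (fun m hm ε => ?_)
      (fun m hm g hg => ?_)
    · exact exists_pull_of_push_eq_zero h ε (hM.ext_eq_zero hm a.as.property _)
    · obtain ⟨k, rfl⟩ := exists_lift_of_pull_eq_zero h g hg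
      exact ⟨k, by simp⟩
  · intro X
    obtain ⟨m₀, m₁, x, y, δ, h₀, h₁, h⟩ := hM.exists_isTriangle_left hI X
    exact ⟨⟨⟨m₀, h₀⟩⟩, ⟨⟨m₁, h₁⟩⟩, _, _, x, ObjectProperty.homMk y, δ, h, rfl, rfl⟩
  · rintro X X' a b a' b' _ _ _ _ ⟨x, f, δ, h, rfl, rfl⟩ ⟨x', f', δ', h', rfl, rfl⟩ α β hαβ
    obtain ⟨α, rfl⟩ := (subFunctor M 𝓔.proj).map_surjective (X := a.as) (Y := a'.as) α
    obtain ⟨β, rfl⟩ := (subFunctor M 𝓔.proj).map_surjective (X := b.as) (Y := b'.as) β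
    have hαβ' := (subFunctor_map_eq_iff hM.proj_le (f ≫ β) (α ≫ f')).1 hαβ
    obtain ⟨P, hP, u, v, huv⟩ := exists_factor_proj hαβ'
    -- The defect factors through a projective, which lifts along the deflation `f'`. Here `α` is
    -- corrected and `β` stays, so (ET3)ᵒᵖ yields `t_* δ = β^* δ'` exactly.
    obtain ⟨v', rfl⟩ := hP f'.hom ⟨_, _, _, h'⟩ v
    obtain ⟨t, -, ht⟩ := 𝓔.et3_op h h' (α.hom + u ≫ v') β.hom (by
      rw [Preadditive.add_comp, Category.assoc, huv]
      simp)
    refine ⟨t, ?_⟩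
    rw [app_extMk, ht]
    exact (map_extMk β δ').symm
  · rintro a b f
    obtain ⟨f, rfl⟩ := (subFunctor M 𝓔.proj).map_surjective (X := a.as) (Y := b.as) f
    obtain ⟨K, P, i, p, lam, hP, hp⟩ := hP b.as.obj
    obtain ⟨X, x, δ, h⟩ := isDeflation_desc f.hom ⟨K, i, lam, hp⟩
    -- The triangle is `X ⟶ a ⊞ P ⟶ b`; the summand `P` disappears modulo `[𝒫]`.
    refine ⟨X, extMk δ, hM.isPresentation_restrictedExt f δ ?_ (fun m hm ε => ?_)
      (fun m hm g hg => ?_)⟩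
    · rw [← biprod.inl_desc f.hom p, pull_comp, pull_eq_zero h, pull_zero]
    · exact exists_pull_of_push_eq_zero h ε
        (hM.ext_eq_zero hm (hM.biprod_mem a.as.property (hM.proj_le _ hP)) _)
    · obtain ⟨k, rfl⟩ := exists_lift_of_pull_eq_zero h g hg
      refine ⟨k ≫ biprod.fst, ?_⟩
      have : (k ≫ biprod.fst) ≫ f.hom - k ≫ biprod.desc f.hom p = (-(k ≫ biprod.snd)) ≫ p := by
        simp [biprod.desc_eq]
      rw [this]
      exact mem_ideal_of_factor hP _ _

end IsClusterTilting

end Extriangulation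

/-! ### Comparison of `Mᵒᵖ/[Dᵒᵖ]` with `(M/[D])ᵒᵖ` -/

namespace IdealQuot

variable {C : Type u} [Category.{v} C] [Preadditive C] (M D : ObjectProperty C)

/-- The full subcategory of `Cᵒᵖ` on `M` is the opposite of the full subcategory `M`. -/
def opFullSubcategory : M.op.FullSubcategory ⥤ M.FullSubcategoryᵒᵖ where
  obj X := op ⟨X.obj.unop, X.property⟩
  map f := Quiver.Hom.op (ObjectProperty.homMk f.hom.unop)

instance : (opFullSubcategory M).Full := ⟨fun f => ⟨ObjectProperty.homMk f.unop.hom.op, rfl⟩⟩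

instance : (opFullSubcategory M).Additive where

instance : (opFullSubcategory M ⋙ (subFunctor M D).op).EssSurj :=
  ⟨fun X => ⟨⟨op X.unop.as.obj, X.unop.as.property⟩, ⟨Iso.refl _⟩⟩⟩

variable {M D}

lemma exists_sub_op_equivalence (hD : D ≤ M) :
    ∃ e : sub M.op D.op ≌ (sub M D)ᵒᵖ, e.functor.Additive := by
  obtain ⟨e, he⟩ := exists_equivalence (D.op.inverseImage M.op.ι)
    (opFullSubcategory M ⋙ (subFunctor M D).op) fun {X Y} f g => by
      refine Quiver.Hom.op_inj.eq_iff.trans ((subFunctor_map_eq_iff hD _ _).trans ?_)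
      change (f - g).hom.unop ∈ ideal D Y.obj.unop X.obj.unop ↔ _
      rw [← mem_ideal_op_iff]
      exact ⟨fun h => homMk_mem_ideal (D := D.op) (M := M.op) (fun Z hZ => hD _ hZ) h,
        fun h => hom_mem_ideal h⟩
  exact ⟨e, he⟩

lemma nonempty_FPMod_sub_op_equivalence (hD : D ≤ M) :
    Nonempty (FPMod (sub M.op D.op) ≌ FPMod (sub M D)ᵒᵖ) := by
  obtain ⟨e, he⟩ := exists_sub_op_equivalence hD
  exact nonempty_FPMod_equivalence e

end IdealQuot

end

theorem mainTheorem7 {𝒞 : Type u} [Category.{v} 𝒞] [Preadditive 𝒞] [HasZeroObject 𝒞]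
    [HasBinaryBiproducts 𝒞]
    (𝓔 : Extriangulation.{w} 𝒞) (hP : 𝓔.EnoughProj) (hI : 𝓔.EnoughInj)
    (M : ObjectProperty 𝒞) (hM : 𝓔.IsClusterTilting M) :
    (Nonempty (IdealQuot M ≌ FPMod (IdealQuot.sub M 𝓔.proj)) ∧
      Nonempty (FPMod (IdealQuot.sub M 𝓔.proj) ≌ (FPMod ((IdealQuot.sub M 𝓔.inj)ᵒᵖ))ᵒᵖ)) ∧
    Nonempty (IdealQuot (𝓔.syzygy M) ≌ (FPMod ((IdealQuot.sub M 𝓔.proj)ᵒᵖ))ᵒᵖ) ∧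
    Nonempty (IdealQuot (𝓔.cosyzygy M) ≌ FPMod (IdealQuot.sub M 𝓔.inj)) := by
  have hsmall : ∀ C A : 𝒞, Small.{v} (𝓔.Ext C A) := Extriangulation.small_ext hP
  have hsmall' : ∀ C A : 𝒞ᵒᵖ, Small.{v} (𝓔.op.Ext C A) := fun C A => hsmall A.unop C.unop
  obtain ⟨e₁⟩ := hM.nonempty_equivalence_idealQuot hP hI
  refine ⟨⟨⟨e₁⟩, ?_⟩, ?_, hM.nonempty_equivalence_cosyzygy hP hI⟩
  -- In `𝒞ᵒᵖ` the projectives are the injectives of `𝒞`. The equivalence out of `𝒞ᵒᵖ/[Mᵒᵖ]`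
  -- therefore involves `M/[ℐ]`; dualizing it and composing with `e₁` compares the two module
  -- categories.
  · obtain ⟨e₂⟩ := hM.op.nonempty_equivalence_idealQuot hI.op hP.op
    rw [Extriangulation.op_proj] at e₂
    obtain ⟨e₃⟩ := IdealQuot.nonempty_op_equivalence M
    obtain ⟨e₄⟩ := IdealQuot.nonempty_FPMod_sub_op_equivalence hM.inj_le
    exact ⟨e₁.symm.trans ((opOpEquivalence _).symm.trans (e₃.symm.trans (e₂.trans e₄)).op)⟩
  -- The cosyzygies of `Mᵒᵖ` in `𝒞ᵒᵖ` are the syzygies of `M` in `𝒞`.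
  · obtain ⟨e₂⟩ := hM.op.nonempty_equivalence_cosyzygy hI.op hP.op
    rw [Extriangulation.op_inj, Extriangulation.op_cosyzygy] at e₂
    obtain ⟨e₃⟩ := IdealQuot.nonempty_op_equivalence (𝓔.syzygy M)
    obtain ⟨e₄⟩ := IdealQuot.nonempty_FPMod_sub_op_equivalence hM.proj_le
    exact ⟨(opOpEquivalence _).symm.trans (e₃.symm.trans (e₂.trans e₄)).op⟩
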